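/- Let $K$ be a field of characteristic different from $2$. Let $A=A_0\oplus A_1$ be a commutative Hopf superalgebra over $K$, i.e. a $\mathbb Z/2$-graded associative unital $K$-algebra with $ab=(-1)^{|a||b|}ba$ for all homogeneous $a,b\in A$, together with an even coassociative comultiplication $\delta:A\to A\otimes_K A$ and an even counit $\epsilon:A\to K$ which are homomorphisms of algebras (where $(a\otimes b)(a'\otimes b')=(-1)^{|b||a'|}aa'\otimes bb'$), and an even antipode $s:A\to A$. Let $B\subseteq A$ be a Hopf supersubalgebra, i.e. a unital subalgebra that is a graded subspace and satisfies $\delta(B)\subseteq B\otimes_K B$ and $s(B)\subseteq B$. Then $A$ is faithfully flat both as a left and as a right $B$-module (via left and right multiplication, forgetting the grading): a sequence $X'\to X\to X''$ of right $B$-modules is exact if and only if $X'\otimes_B A\to X\otimes_B A\to X''\otimes_B A$ is exact, and a sequence $X'\to X\to X''$ of left $B$-modules is exact if and only if $A\otimes_B X'\to A\otimes_B X\to A\otimes_B X''$ is exact. In particular, $A$ is faithfully flat as a left and as a right $B$-supermodule, i.e. the same two equivalences hold for sequences of right, respectively left, $B$-supermodules and even morphisms. -/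

import Mathlib

open scoped TensorProduct

universe u v w

/-! ## Tensor products over a not necessarily commutative ring

A right `R`-module is a module over `Rᵐᵒᵖ`, with `x · r = MulOpposite.op r • x`. -/

namespace BalancedTensor

section

variable (R : Type*) [Ring R]
variable (X : Type*) [AddCommGroup X] [Module Rᵐᵒᵖ X]
variable (Y : Type*) [AddCommGroup Y] [Module R Y]

/-- The subgroup of `X ⊗_ℤ Y` generated by the elements `x r ⊗ y - x ⊗ r y`. -/
def relations : AddSubgroup (X ⊗[ℤ] Y) :=
  AddSubgroup.closure
    {t | ∃ (x : X) (r : R) (y : Y), t = (MulOpposite.op r • x) ⊗ₜ[ℤ] y - x ⊗ₜ[ℤ] (r • y)}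

end

end BalancedTensor

/-- The abelian group `X ⊗_R Y` of a right `R`-module `X` and a left `R`-module `Y`. -/
abbrev BalancedTensor (R : Type*) [Ring R] (X : Type*) [AddCommGroup X] [Module Rᵐᵒᵖ X]
    (Y : Type*) [AddCommGroup Y] [Module R Y] : Type _ :=
  (X ⊗[ℤ] Y) ⧸ BalancedTensor.relations R X Y

namespace BalancedTensor

/-- The map `f ⊗ g : X ⊗_R Y → X' ⊗_R Y'` induced by a morphism `f` of right modules and a
morphism `g` of left modules. -/
def map {R : Type*} [Ring R] {X X' Y Y' : Type*}
    [AddCommGroup X] [Module Rᵐᵒᵖ X] [AddCommGroup X'] [Module Rᵐᵒᵖ X']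
    [AddCommGroup Y] [Module R Y] [AddCommGroup Y'] [Module R Y']
    (f : X →ₗ[Rᵐᵒᵖ] X') (g : Y →ₗ[R] Y') :
    BalancedTensor R X Y →+ BalancedTensor R X' Y' :=
  QuotientAddGroup.map (relations R X Y) (relations R X' Y')
    (TensorProduct.map f.toAddMonoidHom.toIntLinearMap
      g.toAddMonoidHom.toIntLinearMap).toAddMonoidHom
    ((AddSubgroup.closure_le _).2 (by
      rintro _ ⟨x, r, y, rfl⟩
      refine AddSubgroup.subset_closure ⟨f x, r, g y, ?_⟩
      rw [map_sub]
      change f (MulOpposite.op r • x) ⊗ₜ[ℤ] g y - f x ⊗ₜ[ℤ] g (r • y) = _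
      rw [map_smul, map_smul]))

end BalancedTensor

/-! ## Faithful flatness -/

/-- A left `R`-module `Y` is faithfully flat if a sequence `X' → X → X''` of right `R`-modules is
exact if and only if the sequence `X' ⊗_R Y → X ⊗_R Y → X'' ⊗_R Y` is exact. -/
def IsFaithfullyFlatLeft.{w', u', v'} (R : Type u') [Ring R] (Y : Type v') [AddCommGroup Y]
    [Module R Y] : Prop :=
  ∀ (X' X X'' : Type w') [AddCommGroup X'] [AddCommGroup X] [AddCommGroup X'']
    [Module Rᵐᵒᵖ X'] [Module Rᵐᵒᵖ X] [Module Rᵐᵒᵖ X'']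
    (f : X' →ₗ[Rᵐᵒᵖ] X) (g : X →ₗ[Rᵐᵒᵖ] X''),
    Function.Exact f g ↔
      Function.Exact (BalancedTensor.map f (LinearMap.id : Y →ₗ[R] Y))
        (BalancedTensor.map g (LinearMap.id : Y →ₗ[R] Y))

/-- A right `R`-module `Y` is faithfully flat if a sequence `X' → X → X''` of left `R`-modules is
exact if and only if the sequence `Y ⊗_R X' → Y ⊗_R X → Y ⊗_R X''` is exact. -/
def IsFaithfullyFlatRight.{w', u', v'} (R : Type u') [Ring R] (Y : Type v') [AddCommGroup Y]
    [Module Rᵐᵒᵖ Y] : Prop :=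
  ∀ (X' X X'' : Type w') [AddCommGroup X'] [AddCommGroup X] [AddCommGroup X'']
    [Module R X'] [Module R X] [Module R X'']
    (f : X' →ₗ[R] X) (g : X →ₗ[R] X''),
    Function.Exact f g ↔
      Function.Exact (BalancedTensor.map (LinearMap.id : Y →ₗ[Rᵐᵒᵖ] Y) f)
        (BalancedTensor.map (LinearMap.id : Y →ₗ[Rᵐᵒᵖ] Y) g)

/-- `X = X₀ ⊕ X₁` is a left supermodule over the superring `R = R₀ ⊕ R₁`. -/
structure IsLeftSupermodule {R : Type*} [Ring R] (ℛ : ZMod 2 → AddSubgroup R)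
    {X : Type*} [AddCommGroup X] [Module R X] (𝒳 : ZMod 2 → AddSubgroup X) : Prop where
  isInternal : DirectSum.IsInternal 𝒳
  smul_mem : ∀ (i j : ZMod 2) (r : R) (x : X), r ∈ ℛ i → x ∈ 𝒳 j → r • x ∈ 𝒳 (i + j)

/-- `X = X₀ ⊕ X₁` is a right supermodule over the superring `R = R₀ ⊕ R₁`. -/
structure IsRightSupermodule {R : Type*} [Ring R] (ℛ : ZMod 2 → AddSubgroup R)
    {X : Type*} [AddCommGroup X] [Module Rᵐᵒᵖ X] (𝒳 : ZMod 2 → AddSubgroup X) : Prop where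
  isInternal : DirectSum.IsInternal 𝒳
  smul_mem : ∀ (i j : ZMod 2) (x : X) (r : R),
    x ∈ 𝒳 i → r ∈ ℛ j → MulOpposite.op r • x ∈ 𝒳 (i + j)

/-- Faithful flatness of a left `R`-supermodule `Y`: as for modules, but only sequences of right
supermodules and even morphisms are tested. (The tensor products carry the total grading, which
plays no role for exactness.) -/
def IsSuperFaithfullyFlatLeft.{w', u', v'} {R : Type u'} [Ring R] (ℛ : ZMod 2 → AddSubgroup R)
    (Y : Type v') [AddCommGroup Y] [Module R Y] : Prop :=
  ∀ (X' X X'' : Type w') [AddCommGroup X'] [AddCommGroup X] [AddCommGroup X'']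
    [Module Rᵐᵒᵖ X'] [Module Rᵐᵒᵖ X] [Module Rᵐᵒᵖ X'']
    (𝒳' : ZMod 2 → AddSubgroup X') (𝒳 : ZMod 2 → AddSubgroup X) (𝒳'' : ZMod 2 → AddSubgroup X'')
    (_ : IsRightSupermodule ℛ 𝒳') (_ : IsRightSupermodule ℛ 𝒳) (_ : IsRightSupermodule ℛ 𝒳'')
    (f : X' →ₗ[Rᵐᵒᵖ] X) (g : X →ₗ[Rᵐᵒᵖ] X'')
    (_ : ∀ i, ∀ x ∈ 𝒳' i, f x ∈ 𝒳 i) (_ : ∀ i, ∀ x ∈ 𝒳 i, g x ∈ 𝒳'' i),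
    Function.Exact f g ↔
      Function.Exact (BalancedTensor.map f (LinearMap.id : Y →ₗ[R] Y))
        (BalancedTensor.map g (LinearMap.id : Y →ₗ[R] Y))

/-- Faithful flatness of a right `R`-supermodule `Y`: as for modules, but only sequences of left
supermodules and even morphisms are tested. -/
def IsSuperFaithfullyFlatRight.{w', u', v'} {R : Type u'} [Ring R] (ℛ : ZMod 2 → AddSubgroup R)
    (Y : Type v') [AddCommGroup Y] [Module Rᵐᵒᵖ Y] : Prop :=
  ∀ (X' X X'' : Type w') [AddCommGroup X'] [AddCommGroup X] [AddCommGroup X'']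
    [Module R X'] [Module R X] [Module R X'']
    (𝒳' : ZMod 2 → AddSubgroup X') (𝒳 : ZMod 2 → AddSubgroup X) (𝒳'' : ZMod 2 → AddSubgroup X'')
    (_ : IsLeftSupermodule ℛ 𝒳') (_ : IsLeftSupermodule ℛ 𝒳) (_ : IsLeftSupermodule ℛ 𝒳'')
    (f : X' →ₗ[R] X) (g : X →ₗ[R] X'')
    (_ : ∀ i, ∀ x ∈ 𝒳' i, f x ∈ 𝒳 i) (_ : ∀ i, ∀ x ∈ 𝒳 i, g x ∈ 𝒳'' i),
    Function.Exact f g ↔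
      Function.Exact (BalancedTensor.map (LinearMap.id : Y →ₗ[Rᵐᵒᵖ] Y) f)
        (BalancedTensor.map (LinearMap.id : Y →ₗ[Rᵐᵒᵖ] Y) g)

/-! ## Hopf superalgebras

A `K`-superalgebra is a `K`-algebra `A` with a grading `𝒜 : ZMod 2 → Submodule K A`
(`GradedAlgebra 𝒜`). -/

/-- A superalgebra is commutative if `a b = (-1)^{|a||b|} b a` for homogeneous `a`, `b`. -/
def IsSupercommutative {K : Type*} [Field K] {A : Type*} [Ring A] [Algebra K A]
    (𝒜 : ZMod 2 → Submodule K A) : Prop :=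
  ∀ (i j : ZMod 2) (a b : A), a ∈ 𝒜 i → b ∈ 𝒜 j → a * b = (-1 : ℤˣ) ^ (i * j) • (b * a)

/-- The degree `i` part of the superspace `A ⊗ A`, i.e. `∑ⱼ Aⱼ ⊗ A_{i-j}`. -/
def tensorSquareGrading {K : Type*} [Field K] {A : Type*} [Ring A] [Algebra K A]
    (𝒜 : ZMod 2 → Submodule K A) (i : ZMod 2) : Submodule K (A ⊗[K] A) :=
  ⨆ j : ZMod 2, LinearMap.range (TensorProduct.mapIncl (𝒜 j) (𝒜 (i - j)))

/-- A Hopf superalgebra: a superalgebra with a coalgebra structure such that comultiplication and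
counit are even and are homomorphisms of algebras, where `A ⊗ A` has the multiplication
`(a ⊗ b) (a' ⊗ b') = (-1)^{|b||a'|} a a' ⊗ b b'`, together with an (even) antipode. -/
class HopfSuperalgebra (K : Type u) [Field K] {A : Type v} [Ring A] [Algebra K A]
    [Coalgebra K A] (𝒜 : ZMod 2 → Submodule K A) [GradedAlgebra 𝒜] where
  comul_mem : ∀ (i : ZMod 2) (a : A), a ∈ 𝒜 i →
    Coalgebra.comul (R := K) a ∈ tensorSquareGrading 𝒜 i
  comul_one : GradedTensorProduct.of K 𝒜 𝒜 (Coalgebra.comul (R := K) (1 : A)) = 1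
  comul_mul : ∀ a b : A,
    GradedTensorProduct.of K 𝒜 𝒜 (Coalgebra.comul (R := K) (a * b)) =
      GradedTensorProduct.of K 𝒜 𝒜 (Coalgebra.comul (R := K) a) *
        GradedTensorProduct.of K 𝒜 𝒜 (Coalgebra.comul (R := K) b)
  counit_odd : ∀ a : A, a ∈ 𝒜 1 → Coalgebra.counit (R := K) a = 0
  counit_one : Coalgebra.counit (R := K) (1 : A) = 1
  counit_mul : ∀ a b : A,
    Coalgebra.counit (R := K) (a * b) =
      Coalgebra.counit (R := K) a * Coalgebra.counit (R := K) b
  /-- The antipode. -/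
  antipode : A →ₗ[K] A
  antipode_mem : ∀ (i : ZMod 2) (a : A), a ∈ 𝒜 i → antipode a ∈ 𝒜 i
  mul_antipode_rTensor_comul :
    LinearMap.mul' K A ∘ₗ antipode.rTensor A ∘ₗ Coalgebra.comul =
      Algebra.linearMap K A ∘ₗ Coalgebra.counit
  mul_antipode_lTensor_comul :
    LinearMap.mul' K A ∘ₗ antipode.lTensor A ∘ₗ Coalgebra.comul =
      Algebra.linearMap K A ∘ₗ Coalgebra.counit

/-- A Hopf supersubalgebra `B` of `A`: a unital subalgebra which is a graded subspace, is mapped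
into `B ⊗ B` by the comultiplication, and is stable under the antipode. -/
structure IsHopfSupersubalgebra {K : Type u} [Field K] {A : Type v} [Ring A] [Algebra K A]
    [Coalgebra K A] (𝒜 : ZMod 2 → Submodule K A) [GradedAlgebra 𝒜] [HopfSuperalgebra K 𝒜]
    (B : Subalgebra K A) : Prop where
  graded : ∀ b ∈ B, ∀ i : ZMod 2, (DirectSum.decompose 𝒜 b i : A) ∈ B
  comul_mem : ∀ b ∈ B, Coalgebra.comul (R := K) b ∈
    LinearMap.range (TensorProduct.mapIncl (Subalgebra.toSubmodule B) (Subalgebra.toSubmodule B))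
  antipode_mem : ∀ b ∈ B, HopfSuperalgebra.antipode 𝒜 b ∈ B

/-- The grading `Bᵢ = B ∩ Aᵢ` of a supersubalgebra. -/
def subalgebraGrading {K : Type u} [Field K] {A : Type v} [Ring A] [Algebra K A]
    (𝒜 : ZMod 2 → Submodule K A) (B : Subalgebra K A) (i : ZMod 2) : AddSubgroup B :=
  (𝒜 i).toAddSubgroup.comap (B.val : B →+ A)

/-- The right `B`-module structure of an algebra `A` with a subalgebra `B`, given by right
multiplication. -/
instance subalgebraRightModule {K : Type u} [Field K] {A : Type v} [Ring A] [Algebra K A]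
    (B : Subalgebra K A) : Module Bᵐᵒᵖ A :=
  Module.compHom A (RingHom.op (B.val : B →+* A))

theorem subalgebraRightModule_smul {K : Type u} [Field K] {A : Type v} [Ring A] [Algebra K A]
    (B : Subalgebra K A) (b : B) (a : A) : MulOpposite.op b • a = a * (b : A) :=
  rfl

/-! The heart is a homogeneity argument for relative Hopf modules, that is, left `B`-modules with a
compatible left `A`-coaction: a finitely generated one, `N`, is projective over `B`
(`IsHopfModule.projective`).

Near the counit this is linear algebra. Lift a basis of `N / B⁺N` to elements of `N`. By Nakayama
some even `b` of augmentation one carries `N` into their `B`-span. The coaction turns the dual basis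
into `B`-linear maps `N → A`, and the antipode shows that the matrix of these maps on the lifts is
invertible on one side up to the scalar `b`. After multiplication by a power of `b` the inverse
becomes two-sided, so an even element of augmentation one acts on `N` as a sum of endomorphisms
factoring through `B` (`exists_factor_near_augmentation`).

The even elements of `B` acting in this way form an ideal `I` of the even part of `B`. The coaction
allows `I` to be translated by points of `A` in a commutative algebra (`mulEnd_slice_push_mem`).
Moving the counit to a general point shows that `I` contains `1` modulo nilpotents, hence contains
`1`, and the identity of `N` is a sum of maps through `B`.

Supercommutativity enters through a commutative quotient `C` of `A` whose kernel consists of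
elements with nilpotent even part. Determinants are computed over `C`, and the error is a nilpotent
matrix over `A` (`isNilpotent_matrix`); this needs odd elements to square to zero, hence
characteristic different from 2.

To pass to `A` itself, put a finite subset of `A` together with `1` into a finite-dimensional left
coideal `V`. Both `BV` and `BV / B` are finitely generated Hopf modules, hence projective, so `BV`
has a finite dual basis and `B` splits off from it (`exists_projective_submodule`). Each instance of
exactness involves finitely many elements of `A`, so this local information suffices. The right-hand
version follows by inserting signs into the functionals. -/

namespace IsSupercommutative

/-! ### Supercommutative algebras and their commutative quotient -/

section

variable {K : Type*} [Field K] {A : Type*} [Ring A] [Algebra K A]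
  (𝒜 : ZMod 2 → Submodule K A) [GradedAlgebra 𝒜]

local notation "pr" => GradedAlgebra.proj 𝒜

theorem proj_mem (i : ZMod 2) (a : A) : pr i a ∈ 𝒜 i := by
  rw [GradedAlgebra.proj_apply]
  exact SetLike.coe_mem _

theorem proj_of_mem {i : ZMod 2} {a : A} (h : a ∈ 𝒜 i) : pr i a = a := by
  rw [GradedAlgebra.proj_apply, DirectSum.decompose_of_mem_same 𝒜 h]

theorem proj_of_mem_ne {i j : ZMod 2} {a : A} (h : a ∈ 𝒜 i) (hij : i ≠ j) : pr j a = 0 := by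
  rw [GradedAlgebra.proj_apply, DirectSum.decompose_of_mem_ne 𝒜 h hij]

theorem proj_add_proj (a : A) : pr 0 a + pr 1 a = a := by
  classical
  have h := DirectSum.sum_support_decompose 𝒜 a
  rw [Finset.sum_subset (Finset.subset_univ _)] at h
  · rw [GradedAlgebra.proj_apply, GradedAlgebra.proj_apply]
    exact (Fin.sum_univ_two fun i : Fin 2 => ((DirectSum.decompose 𝒜 a) i : A)).symm.trans h
  · intro i _ hi
    simpa using hi

theorem proj_mul_zero (a b : A) : pr 0 (a * b) = pr 0 a * pr 0 b + pr 1 a * pr 1 b := by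
  have e : a * b = (pr 0 a * pr 0 b + pr 1 a * pr 1 b) + (pr 0 a * pr 1 b + pr 1 a * pr 0 b) := by
    conv_lhs => rw [← proj_add_proj 𝒜 a, ← proj_add_proj 𝒜 b]
    noncomm_ring
  have h0 : pr 0 a * pr 0 b + pr 1 a * pr 1 b ∈ 𝒜 0 :=
    add_mem (by simpa using SetLike.mul_mem_graded (proj_mem 𝒜 0 a) (proj_mem 𝒜 0 b))
      (SetLike.mul_mem_graded (proj_mem 𝒜 1 a) (proj_mem 𝒜 1 b))
  have h1 : pr 0 a * pr 1 b + pr 1 a * pr 0 b ∈ 𝒜 1 :=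
    add_mem (by simpa using SetLike.mul_mem_graded (proj_mem 𝒜 0 a) (proj_mem 𝒜 1 b))
      (by simpa using SetLike.mul_mem_graded (proj_mem 𝒜 1 a) (proj_mem 𝒜 0 b))
  rw [e, map_add, proj_of_mem 𝒜 h0, proj_of_mem_ne 𝒜 h1 (by decide), add_zero]

theorem proj_mul_one (a b : A) : pr 1 (a * b) = pr 1 a * pr 0 b + pr 0 a * pr 1 b := by
  have h := proj_add_proj 𝒜 (a * b)
  rw [proj_mul_zero, add_comm] at h
  rw [eq_sub_of_add_eq h]
  conv_lhs => rw [← proj_add_proj 𝒜 a, ← proj_add_proj 𝒜 b]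
  simp only [map_add, proj_of_mem 𝒜 (proj_mem 𝒜 0 _), proj_of_mem 𝒜 (proj_mem 𝒜 1 _),
    proj_of_mem_ne 𝒜 (proj_mem 𝒜 0 _) (show (0 : ZMod 2) ≠ 1 by decide),
    proj_of_mem_ne 𝒜 (proj_mem 𝒜 1 _) (show (1 : ZMod 2) ≠ 0 by decide)]
  noncomm_ring

theorem sum_zmod_two {M : Type*} [AddCommMonoid M] (f : ZMod 2 → M) :
    ∑ i, f i = f 0 + f 1 :=
  Fin.sum_univ_two f

theorem proj_mul (j : ZMod 2) (a b : A) :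
    pr j (a * b) = ∑ i : ZMod 2, pr (j + i) a * pr i b := by
  rw [sum_zmod_two]
  fin_cases j
  · exact proj_mul_zero 𝒜 a b
  · exact proj_mul_one 𝒜 a b

/-- The parity involution `a ↦ (-1)^{|a|} a`. -/
def parity : A →ₗ[K] A := pr 0 - pr 1

variable {𝒜}

omit [GradedAlgebra 𝒜] in
theorem even_mul_of_mem (hA : IsSupercommutative 𝒜) {a : A} (ha : a ∈ 𝒜 0) {i : ZMod 2} {b : A} (hb : b ∈ 𝒜 i) :
    a * b = b * a := by
  simpa using hA 0 i a b ha hb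

theorem even_mul (hA : IsSupercommutative 𝒜) {a : A} (ha : a ∈ 𝒜 0) (b : A) : a * b = b * a := by
  rw [← proj_add_proj 𝒜 b, mul_add, add_mul, hA.even_mul_of_mem ha (proj_mem 𝒜 0 b),
    hA.even_mul_of_mem ha (proj_mem 𝒜 1 b)]

omit [GradedAlgebra 𝒜] in
theorem odd_mul_odd (hA : IsSupercommutative 𝒜) {a b : A} (ha : a ∈ 𝒜 1) (hb : b ∈ 𝒜 1) : a * b = -(b * a) := by
  have := hA 1 1 a b ha hb
  simpa using this

theorem odd_mul (hA : IsSupercommutative 𝒜) {a : A} (ha : a ∈ 𝒜 1) (b : A) : b * a = a * parity 𝒜 b := by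
  conv_lhs => rw [← proj_add_proj 𝒜 b]
  rw [parity, LinearMap.sub_apply, add_mul, mul_sub, hA.even_mul (proj_mem 𝒜 0 b),
    hA.odd_mul_odd (proj_mem 𝒜 1 b) ha, sub_eq_add_neg]

omit [GradedAlgebra 𝒜] in
theorem odd_mul_self (hA : IsSupercommutative 𝒜) (hK : ringChar K ≠ 2) {a : A} (ha : a ∈ 𝒜 1) : a * a = 0 := by
  have h := hA.odd_mul_odd ha ha
  have h2 : (2 : K) ≠ 0 := Ring.two_ne_zero hK
  have h3 : (2 : K) • (a * a) = 0 := by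
    rw [two_smul]
    nth_rewrite 1 [h]
    simp
  exact (smul_eq_zero.1 h3).resolve_left h2

omit [GradedAlgebra 𝒜] in
theorem isNilpotent_odd_mul_odd (hA : IsSupercommutative 𝒜) (hK : ringChar K ≠ 2) {a b : A}
    (ha : a ∈ 𝒜 1) (hb : b ∈ 𝒜 1) :
    IsNilpotent (a * b) := by
  refine ⟨2, ?_⟩
  rw [pow_two, show a * b * (a * b) = a * (b * a) * b by noncomm_ring, hA.odd_mul_odd hb ha,
    show a * -(a * b) * b = -((a * a) * (b * b)) by noncomm_ring, hA.odd_mul_self hK ha]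
  simp

/-- The two-sided ideal of the elements with nilpotent even part. -/
def nilIdeal (hA : IsSupercommutative 𝒜) (hK : ringChar K ≠ 2) : Ideal A where
  carrier := {x | IsNilpotent (pr 0 x)}
  zero_mem' := by simp
  add_mem' {x y} hx hy := by
    simp only [Set.mem_ofPred_eq, map_add] at *
    exact Commute.isNilpotent_add (hA.even_mul (proj_mem 𝒜 0 x) _) hx hy
  smul_mem' a x hx := by
    -- The even part of `a x` is `a₀x₀ + a₁x₁`: the first term is nilpotent because `a₀` is central,
    -- the second because odd elements square to zero.
    simp only [Set.mem_ofPred_eq, smul_eq_mul, proj_mul_zero] at *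
    refine Commute.isNilpotent_add ?_ ?_
      (hA.isNilpotent_odd_mul_odd hK (proj_mem 𝒜 1 a) (proj_mem 𝒜 1 x))
    · exact hA.even_mul
        (by simpa using SetLike.mul_mem_graded (proj_mem 𝒜 0 a) (proj_mem 𝒜 0 x)) _
    · exact Commute.isNilpotent_mul_left (hA.even_mul (proj_mem 𝒜 0 a) _) hx

/-- A supercommutative algebra has a commutative quotient in which odd elements vanish and such
that the elements of the kernel have nilpotent even part. -/
theorem exists_commutative_quotient.{v₁} {K : Type*} [Field K] {A : Type v₁} [Ring A] [Algebra K A]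
    {𝒜 : ZMod 2 → Submodule K A} [GradedAlgebra 𝒜] (hA : IsSupercommutative 𝒜) (hK : ringChar K ≠ 2) :
    ∃ (C : Type v₁) (_ : CommRing C) (_ : Algebra K C) (q : A →ₐ[K] C),
      (∀ a ∈ 𝒜 1, q a = 0) ∧ ∀ x, q x = 0 → IsNilpotent (GradedAlgebra.proj 𝒜 0 x) := by
  let J := hA.nilIdeal hK
  have hJ : J.IsTwoSided := ⟨fun {a} b ha => by
    change IsNilpotent (GradedAlgebra.proj 𝒜 0 (a * b))
    rw [proj_mul_zero]
    refine Commute.isNilpotent_add ?_ ?_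
      (hA.isNilpotent_odd_mul_odd hK (proj_mem 𝒜 1 a) (proj_mem 𝒜 1 b))
    · exact hA.even_mul
        (by simpa using SetLike.mul_mem_graded (proj_mem 𝒜 0 a) (proj_mem 𝒜 0 b)) _
    · exact Commute.isNilpotent_mul_right (hA.even_mul (proj_mem 𝒜 0 a) _) ha⟩
  have hodd : ∀ a ∈ 𝒜 1, Ideal.Quotient.mk J a = 0 := fun a ha => by
    rw [Ideal.Quotient.eq_zero_iff_mem]
    change IsNilpotent (GradedAlgebra.proj 𝒜 0 a)
    rw [proj_of_mem_ne 𝒜 ha (by decide)]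
    exact IsNilpotent.zero
  -- Every class is represented by an even element, and even elements are central.
  have hcomm : ∀ x y : A ⧸ J, x * y = y * x := by
    intro x y
    obtain ⟨a, rfl⟩ := Ideal.Quotient.mk_surjective x
    obtain ⟨b, rfl⟩ := Ideal.Quotient.mk_surjective y
    have h : Ideal.Quotient.mk J a = Ideal.Quotient.mk J (GradedAlgebra.proj 𝒜 0 a) := by
      conv_lhs => rw [← proj_add_proj 𝒜 a, map_add, hodd _ (proj_mem 𝒜 1 a), add_zero]
    rw [h, ← map_mul, hA.even_mul (proj_mem 𝒜 0 a), map_mul]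
  refine ⟨A ⧸ J, { (inferInstance : Ring (A ⧸ J)) with mul_comm := hcomm },
    (inferInstance : Algebra K (A ⧸ J)), Ideal.Quotient.mkₐ K J, hodd, fun x hx => ?_⟩
  exact Ideal.Quotient.eq_zero_iff_mem.1 hx

end

end IsSupercommutative

/-! ### Nilpotent matrices over a supercommutative algebra -/

/-- Adding a multiple of a nilpotent normal element preserves nilpotency. -/
theorem IsNilpotent.add_normal_mul {R : Type*} [Ring R] {x z : R} (hx : IsNilpotent x)
    (hz : IsNilpotent z) (hn : ∀ y, ∃ y', y * x = x * y') (y : R) :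
    IsNilpotent (z + x * y) := by
  -- By normality `xR` is a two-sided ideal, and `z + xy` agrees with `z` modulo it. So a power of
  -- `z + xy` has the form `xt`, whose powers `(xt)^k` lie in `x^k R`.
  have h1 : ∀ m : ℕ, ∃ t, (z + x * y) ^ m = z ^ m + x * t := by
    intro m
    induction m with
    | zero => exact ⟨0, by simp⟩
    | succ m ih =>
      obtain ⟨t, ht⟩ := ih
      obtain ⟨s, hs⟩ := hn (z ^ m)
      refine ⟨s * y + t * (z + x * y), ?_⟩
      rw [_root_.pow_succ, ht, _root_.pow_succ, add_mul, mul_add (z ^ m), ← mul_assoc (z ^ m), hs]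
      noncomm_ring
  obtain ⟨m, hm⟩ := hz
  obtain ⟨t, ht⟩ := h1 m
  rw [hm, zero_add] at ht
  have h2 : ∀ k : ℕ, ∃ s, (x * t) ^ k = x ^ k * s := by
    intro k
    induction k with
    | zero => exact ⟨1, by simp⟩
    | succ k ih =>
      obtain ⟨s, hs⟩ := ih
      obtain ⟨s', hs'⟩ := hn s
      refine ⟨s' * t, ?_⟩
      rw [_root_.pow_succ, hs, _root_.pow_succ, mul_assoc, ← mul_assoc s, hs']
      noncomm_ring
  obtain ⟨k, hk⟩ := hx
  obtain ⟨s, hs⟩ := h2 k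
  refine ⟨m * k, ?_⟩
  rw [pow_mul, ht, hs, hk, zero_mul]

namespace IsSupercommutative

variable {K : Type*} [Field K] {A : Type*} [Ring A] [Algebra K A]
  {𝒜 : ZMod 2 → Submodule K A} [GradedAlgebra 𝒜]

/-- Moving a homogeneous scalar past a matrix changes the entries at most by the parity involution,
so a homogeneous scalar matrix is normal. -/
theorem isNilpotent_matrix_add (hA : IsSupercommutative 𝒜) {ι : Type*} [Fintype ι] [DecidableEq ι] {d : ZMod 2} {x : A}
    (hx : x ∈ 𝒜 d) (hn : IsNilpotent x) {Z : Matrix ι ι A} (hZ : IsNilpotent Z)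
    (W : Matrix ι ι A) : IsNilpotent (Z + Matrix.scalar ι x * W) := by
  refine IsNilpotent.add_normal_mul (hn.map (Matrix.scalar ι)) hZ (fun Y => ?_) W
  have h : ∃ f : A → A, ∀ y, y * x = x * f y := by
    fin_cases d
    · exact ⟨id, fun y => (hA.even_mul hx y).symm⟩
    · exact ⟨parity 𝒜, fun y => hA.odd_mul hx y⟩
  obtain ⟨f, hf⟩ := h
  refine ⟨Y.map f, ?_⟩
  ext i j
  simp [Matrix.scalar_apply, hf]

/-- The matrix is built up entry by entry. Each entry contributes its even part, nilpotent by
hypothesis, and its odd part, of square zero; both are normal scalars times a matrix unit. -/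
theorem isNilpotent_matrix (hA : IsSupercommutative 𝒜) (hK : ringChar K ≠ 2) {ι : Type*} [Fintype ι] [DecidableEq ι]
    (Z : Matrix ι ι A) (hZ : ∀ i j, IsNilpotent (GradedAlgebra.proj 𝒜 0 (Z i j))) :
    IsNilpotent Z := by
  have key : ∀ s : Finset (ι × ι), IsNilpotent
      (∑ p ∈ s, (Matrix.single p.1 p.2 (Z p.1 p.2) : Matrix ι ι A)) := by
    intro s
    induction s using Finset.induction_on with
    | empty => simp
    | insert p s hp ih =>
      rw [Finset.sum_insert hp]
      have e : (Matrix.single p.1 p.2 (Z p.1 p.2) : Matrix ι ι A) =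
          Matrix.scalar ι (GradedAlgebra.proj 𝒜 0 (Z p.1 p.2)) * Matrix.single p.1 p.2 1 +
          Matrix.scalar ι (GradedAlgebra.proj 𝒜 1 (Z p.1 p.2)) * Matrix.single p.1 p.2 1 := by
        rw [← add_mul, ← map_add, proj_add_proj]
        ext i j
        simp [Matrix.scalar_apply, Matrix.single_apply]
      rw [e, add_comm, ← add_assoc]
      refine hA.isNilpotent_matrix_add (proj_mem 𝒜 1 _) ⟨2, ?_⟩
        (hA.isNilpotent_matrix_add (proj_mem 𝒜 0 _) (hZ _ _) ih _) _
      rw [pow_two]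
      exact hA.odd_mul_self hK (proj_mem 𝒜 1 _)
  have e : Z = ∑ p : ι × ι, (Matrix.single p.1 p.2 (Z p.1 p.2) : Matrix ι ι A) := by
    rw [Fintype.sum_prod_type]
    exact Matrix.matrix_eq_sum_single Z
  rw [e]
  exact key _

end IsSupercommutative

/-! ### Relative Hopf modules -/

namespace IsHopfSupersubalgebra

open IsSupercommutative

variable {K : Type u} [Field K] {A : Type v} [Ring A] [Algebra K A] [Coalgebra K A]
  {𝒜 : ZMod 2 → Submodule K A} [GradedAlgebra 𝒜] [HopfSuperalgebra K 𝒜] {B : Subalgebra K A}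

/-- The projection of a Hopf supersubalgebra onto its part of degree `i`. -/
def proj (hB : IsHopfSupersubalgebra 𝒜 B) (i : ZMod 2) : B →ₗ[K] B where
  toFun b := ⟨GradedAlgebra.proj 𝒜 i b, by
    rw [GradedAlgebra.proj_apply]
    exact hB.graded b b.2 i⟩
  map_add' b c := Subtype.ext (by simp only [Subalgebra.coe_add, map_add])
  map_smul' k c := Subtype.ext (by simp only [Subalgebra.coe_smul, map_smul, RingHom.id_apply])

theorem coe_proj (hB : IsHopfSupersubalgebra 𝒜 B) (i : ZMod 2) (b : B) :
    (hB.proj i b : A) = GradedAlgebra.proj 𝒜 i b := rfl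

theorem proj_add_proj (hB : IsHopfSupersubalgebra 𝒜 B) (b : B) : hB.proj 0 b + hB.proj 1 b = b :=
  Subtype.ext (IsSupercommutative.proj_add_proj 𝒜 (b : A))

variable (B) in
/-- The inclusion of `B` in `A` as a map of left `B`-modules. -/
def inclusion : B →ₗ[B] A where
  toFun b := b
  map_add' _ _ := rfl
  map_smul' _ _ := rfl

omit [Coalgebra K A] in
variable (B) in
theorem lTensor_val_injective :
    Function.Injective (LinearMap.lTensor A B.val.toLinearMap) :=
  Module.Flat.lTensor_preserves_injective_linearMap _ Subtype.val_injective

/-- The comultiplication of a Hopf supersubalgebra `B`, as a map `B → A ⊗ B`. -/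
noncomputable def comul (hB : IsHopfSupersubalgebra 𝒜 B) : B →ₗ[K] A ⊗[K] B :=
  LinearMap.codRestrictOfInjective (Coalgebra.comul ∘ₗ B.val.toLinearMap)
    (LinearMap.lTensor A B.val.toLinearMap) (lTensor_val_injective B) (fun b => by
      obtain ⟨t, ht⟩ := hB.comul_mem b b.2
      refine ⟨LinearMap.rTensor B B.val.toLinearMap t, ?_⟩
      rw [← LinearMap.comp_apply, LinearMap.lTensor_comp_rTensor]
      exact ht)

theorem lTensor_val_comul (hB : IsHopfSupersubalgebra 𝒜 B) (b : B) :
    LinearMap.lTensor A B.val.toLinearMap (hB.comul b) = Coalgebra.comul (R := K) (b : A) :=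
  LinearMap.codRestrictOfInjective_comp_apply _ _ _ _ _

section Act

variable {N : Type*} [AddCommGroup N] [Module K N] [Module B N] [IsScalarTower K B N]
  {N' : Type*} [AddCommGroup N'] [Module K N'] [Module B N'] [IsScalarTower K B N']

variable (N) in
/-- The action `(a ⊗ b) (a' ⊗ n) = (-1)^{|b||a'|} a a' ⊗ b n` of `A ⊗ B` on `A ⊗ N`. -/
noncomputable def act (hB : IsHopfSupersubalgebra 𝒜 B) :
    A ⊗[K] B →ₗ[K] A ⊗[K] N →ₗ[K] A ⊗[K] N :=
  TensorProduct.map₂ (LinearMap.mul K A)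
      ((Algebra.lsmul K K N : B →ₐ[K] Module.End K N).toLinearMap ∘ₗ hB.proj 0) +
    TensorProduct.map₂ ((LinearMap.mul K A).compl₂ (parity 𝒜))
      ((Algebra.lsmul K K N : B →ₐ[K] Module.End K N).toLinearMap ∘ₗ hB.proj 1)

theorem act_tmul (hB : IsHopfSupersubalgebra 𝒜 B) (a a' : A) (b : B) (n : N) :
    hB.act N (a ⊗ₜ b) (a' ⊗ₜ n) =
      (a * a') ⊗ₜ (hB.proj 0 b • n) + (a * parity 𝒜 a') ⊗ₜ (hB.proj 1 b • n) := by
  simp [act]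

theorem lTensor_act (hB : IsHopfSupersubalgebra 𝒜 B) (f : N →ₗ[B] N') (t : A ⊗[K] B)
    (s : A ⊗[K] N) :
    LinearMap.lTensor A (f.restrictScalars K) (hB.act N t s) =
      hB.act N' t (LinearMap.lTensor A (f.restrictScalars K) s) := by
  induction t with
  | zero => simp
  | add t t' h h' => simp only [map_add, LinearMap.add_apply, h, h']
  | tmul a b =>
    induction s with
    | zero => simp
    | add s s' h h' => simp only [map_add, h, h']
    | tmul a' n => simp [act_tmul]

end Act

/-- Only the pair of odd parts of `b` and `a'` produces a sign, and `parity` records it. Through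
this identity, multiplicativity of the comultiplication makes `A` a Hopf module. -/
theorem of_mul_of (hB : IsHopfSupersubalgebra 𝒜 B) (t : A ⊗[K] B) (s : A ⊗[K] A) :
    GradedTensorProduct.of K 𝒜 𝒜 (LinearMap.lTensor A B.val.toLinearMap t) *
      GradedTensorProduct.of K 𝒜 𝒜 s = GradedTensorProduct.of K 𝒜 𝒜 (hB.act A t s) := by
  have hom : ∀ (i j : ZMod 2) (a a' b c : A), b ∈ 𝒜 i → a' ∈ 𝒜 j →
      GradedTensorProduct.of K 𝒜 𝒜 (a ⊗ₜ b) * GradedTensorProduct.of K 𝒜 𝒜 (a' ⊗ₜ c) =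
      (-1 : ℤˣ) ^ (i * j) • GradedTensorProduct.of K 𝒜 𝒜 ((a * a') ⊗ₜ (b * c)) :=
    fun i j a a' b c hb ha' =>
      GradedTensorProduct.tmul_coe_mul_coe_tmul 𝒜 𝒜 a (⟨b, hb⟩ : 𝒜 i) (⟨a', ha'⟩ : 𝒜 j) c
  induction t with
  | zero => simp
  | add t t' h h' => simp only [map_add, LinearMap.add_apply, h, h', add_mul]
  | tmul a b =>
    induction s with
    | zero => simp
    | add s s' h h' => simp only [map_add, h, h', mul_add]
    | tmul a' c =>
      have e1 : (a ⊗ₜ[K] (b : A) : A ⊗[K] A) =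
          a ⊗ₜ (GradedAlgebra.proj 𝒜 0 (b : A)) + a ⊗ₜ (GradedAlgebra.proj 𝒜 1 (b : A)) := by
        rw [← TensorProduct.tmul_add, IsSupercommutative.proj_add_proj]
      have e2 : (a' ⊗ₜ[K] c : A ⊗[K] A) =
          (GradedAlgebra.proj 𝒜 0 a') ⊗ₜ c + (GradedAlgebra.proj 𝒜 1 a') ⊗ₜ c := by
        rw [← TensorProduct.add_tmul, IsSupercommutative.proj_add_proj]
      have e3 : (a * a' : A) = a * GradedAlgebra.proj 𝒜 0 a' + a * GradedAlgebra.proj 𝒜 1 a' := by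
        rw [← mul_add, IsSupercommutative.proj_add_proj]
      rw [LinearMap.lTensor_tmul, act_tmul, AlgHom.toLinearMap_apply, Subalgebra.coe_val, e1, e2,
        e3]
      simp only [map_add, add_mul, mul_add,
        hom 0 0 _ _ _ _ (proj_mem 𝒜 0 _) (proj_mem 𝒜 0 _),
        hom 1 0 _ _ _ _ (proj_mem 𝒜 1 _) (proj_mem 𝒜 0 _),
        hom 0 1 _ _ _ _ (proj_mem 𝒜 0 _) (proj_mem 𝒜 1 _),
        hom 1 1 _ _ _ _ (proj_mem 𝒜 1 _) (proj_mem 𝒜 1 _)]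
      simp only [parity, LinearMap.sub_apply, mul_sub, TensorProduct.add_tmul,
        TensorProduct.sub_tmul, map_add, map_sub, mul_zero, uzpow_zero, one_smul,
        mul_one, uzpow_one, Units.neg_smul]
      simp only [Subalgebra.smul_def, coe_proj, smul_eq_mul]
      abel

/-- A relative Hopf module: a left `B`-module `N` with a compatible left coaction `ρ` of `A`. -/
structure IsHopfModule (hB : IsHopfSupersubalgebra 𝒜 B) {N : Type*} [AddCommGroup N] [Module K N]
    [Module B N] [IsScalarTower K B N] (ρ : N →ₗ[K] A ⊗[K] N) : Prop where
  coassoc : ∀ n, TensorProduct.assoc K A A N (LinearMap.rTensor N Coalgebra.comul (ρ n)) =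
    LinearMap.lTensor A ρ (ρ n)
  counit : ∀ n, TensorProduct.lid K N (LinearMap.rTensor N Coalgebra.counit (ρ n)) = n
  map_smul : ∀ (b : B) n, ρ (b • n) = hB.act N (hB.comul b) (ρ n)

theorem isHopfModule_self (hB : IsHopfSupersubalgebra 𝒜 B) :
    hB.IsHopfModule (Coalgebra.comul : A →ₗ[K] A ⊗[K] A) where
  coassoc n := Coalgebra.coassoc_apply n
  counit n := by simp
  map_smul b n := by
    apply (GradedTensorProduct.of K 𝒜 𝒜).injective
    rw [← hB.of_mul_of, lTensor_val_comul, ← HopfSuperalgebra.comul_mul]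
    rfl

section Maps

variable {N : Type*} [AddCommGroup N] [Module K N] [Module B N] [IsScalarTower K B N]
  {N' : Type*} [AddCommGroup N'] [Module K N'] [Module B N'] [IsScalarTower K B N']
  {hB : IsHopfSupersubalgebra 𝒜 B} {ρ : N →ₗ[K] A ⊗[K] N} {ρ' : N' →ₗ[K] A ⊗[K] N'}

theorem assoc_rTensor_lTensor (f : N →ₗ[K] N') (t : A ⊗[K] N) :
    TensorProduct.assoc K A A N' (LinearMap.rTensor N' Coalgebra.comul (LinearMap.lTensor A f t)) =
      LinearMap.lTensor A (LinearMap.lTensor A f)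
        (TensorProduct.assoc K A A N (LinearMap.rTensor N Coalgebra.comul t)) := by
  induction t with
  | zero => simp
  | add s s' h h' => simp only [map_add, h, h']
  | tmul a n =>
    simp only [LinearMap.lTensor_tmul, LinearMap.rTensor_tmul]
    induction Coalgebra.comul (R := K) a with
    | zero => simp
    | add s s' h h' => simp only [map_add, TensorProduct.add_tmul, h, h']
    | tmul x y => simp

theorem lid_rTensor_lTensor (f : N →ₗ[K] N') (t : A ⊗[K] N) :
    TensorProduct.lid K N' (LinearMap.rTensor N' Coalgebra.counit (LinearMap.lTensor A f t)) =
      f (TensorProduct.lid K N (LinearMap.rTensor N Coalgebra.counit t)) := by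
  induction t with
  | zero => simp
  | add s s' h h' => simp only [map_add, h, h']
  | tmul a n => simp

omit [Coalgebra K A] in
theorem lTensor_lTensor_of_comm {f : N →ₗ[K] N'}
    (h : ∀ n, LinearMap.lTensor A f (ρ n) = ρ' (f n)) (t : A ⊗[K] N) :
    LinearMap.lTensor A (LinearMap.lTensor A f) (LinearMap.lTensor A ρ t) =
      LinearMap.lTensor A ρ' (LinearMap.lTensor A f t) := by
  induction t with
  | zero => simp
  | add s s' h h' => simp only [map_add, h, h']
  | tmul a n => simp [h]

/-- Over a field `A ⊗ -` preserves injectivity, so the axioms can be checked in the larger module.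
-/
theorem IsHopfModule.of_injective (h : hB.IsHopfModule ρ') (f : N →ₗ[B] N')
    (hf : Function.Injective f)
    (hρ : ∀ n, LinearMap.lTensor A (f.restrictScalars K) (ρ n) = ρ' (f n)) :
    hB.IsHopfModule ρ where
  coassoc n := by
    have i1 : Function.Injective (LinearMap.lTensor A (f.restrictScalars K)) :=
      Module.Flat.lTensor_preserves_injective_linearMap _ hf
    have i2 : Function.Injective (LinearMap.lTensor A (LinearMap.lTensor A (f.restrictScalars K))) :=
      Module.Flat.lTensor_preserves_injective_linearMap _ i1
    apply i2
    rw [← assoc_rTensor_lTensor, lTensor_lTensor_of_comm hρ, hρ, h.coassoc]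
  counit n := by
    apply hf
    have := lid_rTensor_lTensor (f.restrictScalars K) (ρ n)
    rw [hρ, h.counit] at this
    exact this.symm
  map_smul b n := by
    have i1 : Function.Injective (LinearMap.lTensor A (f.restrictScalars K)) :=
      Module.Flat.lTensor_preserves_injective_linearMap _ hf
    apply i1
    rw [lTensor_act, hρ, hρ, ← h.map_smul, f.map_smul]

theorem IsHopfModule.of_surjective (h : hB.IsHopfModule ρ) (f : N →ₗ[B] N')
    (hf : Function.Surjective f)
    (hρ : ∀ n, LinearMap.lTensor A (f.restrictScalars K) (ρ n) = ρ' (f n)) :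
    hB.IsHopfModule ρ' where
  coassoc n' := by
    obtain ⟨n, rfl⟩ := hf n'
    rw [← hρ, assoc_rTensor_lTensor, ← lTensor_lTensor_of_comm hρ, h.coassoc]
  counit n' := by
    obtain ⟨n, rfl⟩ := hf n'
    rw [← hρ, lid_rTensor_lTensor, h.counit]
    rfl
  map_smul b n' := by
    obtain ⟨n, rfl⟩ := hf n'
    rw [← hρ, ← lTensor_act, ← h.map_smul, ← f.map_smul, ← hρ]

theorem isHopfModule_comul (hB : IsHopfSupersubalgebra 𝒜 B) : hB.IsHopfModule hB.comul :=
  hB.isHopfModule_self.of_injective (inclusion B) Subtype.val_injective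
    fun b => hB.lTensor_val_comul b

/-- A Hopf submodule inherits a coaction. -/
theorem IsHopfModule.exists_of_injective (h : hB.IsHopfModule ρ') (f : N →ₗ[B] N')
    (hf : Function.Injective f)
    (hρ : ∀ n, ρ' (f n) ∈ LinearMap.range (LinearMap.lTensor A (f.restrictScalars K))) :
    ∃ ρ : N →ₗ[K] A ⊗[K] N, hB.IsHopfModule ρ ∧
      ∀ n, LinearMap.lTensor A (f.restrictScalars K) (ρ n) = ρ' (f n) := by
  have i1 : Function.Injective (LinearMap.lTensor A (f.restrictScalars K)) :=
    Module.Flat.lTensor_preserves_injective_linearMap _ hf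
  have e : ∀ n, LinearMap.lTensor A (f.restrictScalars K)
      (LinearMap.codRestrictOfInjective (ρ' ∘ₗ f.restrictScalars K) _ i1 hρ n) = ρ' (f n) :=
    LinearMap.codRestrictOfInjective_comp_apply _ _ _ _
  exact ⟨_, h.of_injective f hf e, e⟩

/-- The quotient of a Hopf module by a costable submodule is a Hopf module. -/
theorem IsHopfModule.exists_quotient (h : hB.IsHopfModule ρ) (P : Submodule B N)
    (hP : ∀ n ∈ P, LinearMap.lTensor A (P.mkQ.restrictScalars K) (ρ n) = 0) :
    ∃ ρ' : N ⧸ P →ₗ[K] A ⊗[K] (N ⧸ P), hB.IsHopfModule ρ' := by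
  let g : N →ₗ[K] A ⊗[K] (N ⧸ P) := LinearMap.lTensor A (P.mkQ.restrictScalars K) ∘ₗ ρ
  have hs : Function.Surjective (P.mkQ.restrictScalars K) := P.mkQ_surjective
  have hker : LinearMap.ker (P.mkQ.restrictScalars K) ≤ LinearMap.ker g := fun n hn =>
    hP n ((Submodule.Quotient.mk_eq_zero P).1 hn)
  let e := (P.mkQ.restrictScalars K).quotKerEquivOfSurjective hs
  refine ⟨(LinearMap.ker (P.mkQ.restrictScalars K)).liftQ g hker ∘ₗ e.symm.toLinearMap,
    h.of_surjective P.mkQ P.mkQ_surjective fun n => ?_⟩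
  have : e.symm (P.mkQ n) = Submodule.Quotient.mk n := by
    rw [LinearEquiv.symm_apply_eq]
    rfl
  rw [LinearMap.comp_apply, LinearEquiv.coe_coe, this]
  rfl

end Maps

end IsHopfSupersubalgebra

/-! ### One-sided inverses of matrices -/

/-- Over a supercommutative algebra a one-sided inverse of a matrix, up to an even scalar, becomes
two-sided after multiplication by a power of this scalar. -/
theorem IsSupercommutative.exists_pow_mul_comm {K : Type*} [Field K] {A : Type*} [Ring A]
    [Algebra K A] {𝒜 : ZMod 2 → Submodule K A} [GradedAlgebra 𝒜] (hA : IsSupercommutative 𝒜)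
    (hK : ringChar K ≠ 2) {ι : Type*} [Fintype ι] [DecidableEq ι] (X Y : Matrix ι ι A) {b : A}
    (hb : b ∈ 𝒜 0) (h : Y * X = Matrix.scalar ι b) :
    ∃ k : ℕ, Matrix.scalar ι b ^ k * (X * Y) = Matrix.scalar ι b ^ (k + 1) := by
  obtain ⟨C, _, _, q, -, hq⟩ := hA.exists_commutative_quotient hK
  have hT : ∀ M : Matrix ι ι A, Commute (Matrix.scalar ι b) M := fun M =>
    Matrix.scalar_commute b (fun a => hA.even_mul hb a) M
  set T := Matrix.scalar ι b with hTdef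
  let r := Fintype.card ι
  let Z := T ^ r * (X * Y) - T ^ (r + 1)
  let Q := q.toRingHom.mapMatrix (m := ι)
  have hQT : Q T = q b • (1 : Matrix ι ι C) := by
    ext i j
    by_cases hij : i = j <;> simp [Q, T, Matrix.scalar_apply, hij]
  have h1 : Q Y * Q X = q b • (1 : Matrix ι ι C) := by rw [← map_mul, h, hQT]
  -- Over `C` the adjugate gives the claim up to the factor `det X`. Multiplying by `det Y` replaces
  -- that factor by `q b ^ r`, since `det Y * det X = q b ^ r`.
  have h2 : (Q X).det • (Q X * Q Y) = (q b * (Q X).det) • (1 : Matrix ι ι C) := by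
    have e : Q X * (Q Y * Q X) * (Q X).adjugate = (Q X).det • (Q X * Q Y) := by
      rw [← mul_assoc, mul_assoc (Q X * Q Y), Matrix.mul_adjugate]
      simp
    rw [← e, h1]
    simp [Matrix.mul_adjugate, smul_smul]
  have h3 : (Q Y).det * (Q X).det = q b ^ r := by
    rw [← Matrix.det_mul, h1, Matrix.det_smul, Matrix.det_one, mul_one]
  have h4 : q b ^ r • (Q X * Q Y) = q b ^ (r + 1) • (1 : Matrix ι ι C) := by
    rw [← h3, mul_smul, h2, smul_smul, pow_succ, ← h3]
    congr 1
    ring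
  have hQZ : Q Z = 0 := by
    simp only [Z, map_sub, map_mul, map_pow, hQT, smul_pow, one_pow, smul_mul_assoc, one_mul, h4,
      sub_self]
  obtain ⟨m, hm⟩ := hA.isNilpotent_matrix hK Z fun i j => hq _ (congrFun (congrFun hQZ i) j)
  -- `XY` is idempotent up to the central factor `T`, whence `Z² = -T^(r+1) Z`. Nilpotency of `Z`
  -- thus becomes vanishing of `Z` after multiplication by a power of `T`.
  have hE : (X * Y) * (X * Y) = T * (X * Y) := by
    rw [mul_assoc, ← mul_assoc Y, h, ← mul_assoc, ← (hT X).eq, mul_assoc]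
  have hZZ : Z * Z = -T ^ (r + 1) * Z := by
    have c : ∀ n : ℕ, (X * Y) * T ^ n = T ^ n * (X * Y) := fun n => (((hT _).pow_left n).eq).symm
    simp only [Z, mul_sub, sub_mul]
    rw [mul_assoc (T ^ r), mul_assoc (T ^ r), ← mul_assoc (X * Y) (T ^ r), c, c,
      mul_assoc (T ^ r) (X * Y), hE]
    simp only [pow_succ, ← mul_assoc, neg_mul]
    have : T ^ r * T ^ r * T * X * Y = T ^ r * T * T ^ r * X * Y := by
      rw [mul_assoc (T ^ r) (T ^ r) T, ← pow_succ, ← pow_add, ← pow_add, add_comm]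
    rw [this]
    abel
  have hZp : ∀ n : ℕ, Z ^ (n + 1) = (-T ^ (r + 1)) ^ n * Z := by
    intro n
    induction n with
    | zero => simp
    | succ n ih => rw [pow_succ, ih, mul_assoc, hZZ, ← mul_assoc, ← pow_succ]
  have h5 : T ^ ((r + 1) * m) * Z = 0 := by
    have := hZp m
    rw [pow_succ, hm, zero_mul, neg_pow, ← pow_mul] at this
    rcases neg_one_pow_eq_or (Matrix ι ι A) m with e | e <;> rw [e] at this
    · simpa using this.symm
    · simpa using this.symm
  refine ⟨(r + 1) * m + r, ?_⟩
  rw [mul_sub, sub_eq_zero, ← mul_assoc, ← pow_add, ← pow_add] at h5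
  exact h5

/-! ### The augmentation and Nakayama's lemma -/

/-- The counit of a Hopf superalgebra as a homomorphism of algebras. -/
noncomputable def HopfSuperalgebra.augmentation {K : Type u} [Field K] {A : Type v} [Ring A]
    [Algebra K A] [Coalgebra K A] (𝒜 : ZMod 2 → Submodule K A) [GradedAlgebra 𝒜]
    [HopfSuperalgebra K 𝒜] : A →ₐ[K] K :=
  AlgHom.ofLinearMap Coalgebra.counit (HopfSuperalgebra.counit_one 𝒜)
    (HopfSuperalgebra.counit_mul 𝒜)

namespace IsHopfSupersubalgebra

open IsSupercommutative HopfSuperalgebra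

variable {K : Type u} [Field K] {A : Type v} [Ring A] [Algebra K A] [Coalgebra K A]
  {𝒜 : ZMod 2 → Submodule K A} [GradedAlgebra 𝒜] [HopfSuperalgebra K 𝒜] {B : Subalgebra K A}

theorem augmentation_apply (a : A) : augmentation 𝒜 a = Coalgebra.counit (R := K) a := rfl

theorem augmentation_odd {a : A} (ha : a ∈ 𝒜 1) : augmentation 𝒜 a = 0 :=
  HopfSuperalgebra.counit_odd a ha

theorem augmentation_proj_zero (a : A) :
    augmentation 𝒜 (GradedAlgebra.proj 𝒜 0 a) = augmentation 𝒜 a := by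
  conv_rhs => rw [← IsSupercommutative.proj_add_proj 𝒜 a, map_add,
    augmentation_odd (proj_mem 𝒜 1 a), add_zero]

/-- A matrix reducing to the identity modulo the augmentation ideal is left invertible up to an
even element of augmentation one. -/
theorem exists_mul_eq_scalar (hB : IsHopfSupersubalgebra 𝒜 B) (hA : IsSupercommutative 𝒜)
    (hK : ringChar K ≠ 2) {ι : Type*} [Fintype ι] [DecidableEq ι] (X : Matrix ι ι B)
    (hX : X.map (fun b : B => augmentation 𝒜 (b : A)) = 1) :
    ∃ (U : Matrix ι ι B) (b : B), (b : A) ∈ 𝒜 0 ∧ augmentation 𝒜 (b : A) = 1 ∧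
      U * X = Matrix.scalar ι b := by
  let E : Subalgebra K B :=
    { carrier := {b | (b : A) ∈ 𝒜 0}
      mul_mem' := fun {a b} ha hb => by
        simpa using SetLike.mul_mem_graded (A := 𝒜) ha hb
      add_mem' := fun {a b} ha hb => (𝒜 0).add_mem ha hb
      algebraMap_mem' := fun k => SetLike.algebraMap_mem_graded 𝒜 k }
  let _ : CommRing E := { (inferInstance : Ring E) with
    mul_comm := fun a b => Subtype.ext (Subtype.ext (hA.even_mul a.2 _)) }
  let i : E →+* B := E.val.toRingHom
  -- The even part of `X` has entries in a commutative ring, so its adjugate inverts it up to the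
  -- determinant `d`. The odd part then contributes a matrix `Z` with odd entries, which is
  -- nilpotent.
  let X₀ : Matrix ι ι E := fun k l => ⟨hB.proj 0 (X k l), proj_mem 𝒜 0 _⟩
  let U₀ : Matrix ι ι B := i.mapMatrix X₀.adjugate
  let d : B := i X₀.det
  have hd : (d : A) ∈ 𝒜 0 := X₀.det.2
  have hd1 : augmentation 𝒜 (d : A) = 1 := by
    let ε : E →+* K := ((augmentation 𝒜).toRingHom.comp B.val.toRingHom).comp i
    have : ε.mapMatrix X₀ = 1 := by
      rw [← hX]
      ext k l
      exact augmentation_proj_zero _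
    have h2 : ε X₀.det = 1 := by rw [RingHom.map_det, this, Matrix.det_one]
    exact h2
  have h0 : U₀ * i.mapMatrix X₀ = Matrix.scalar ι d := by
    rw [← map_mul, Matrix.adjugate_mul]
    ext k l
    by_cases hkl : k = l <;> simp [Matrix.scalar_apply, hkl, d]
  let Z := U₀ * (X - i.mapMatrix X₀)
  have hZ : IsNilpotent Z := by
    let j : B →+* A := B.val.toRingHom
    have hj : Function.Injective (j.mapMatrix (m := ι)) :=
      Matrix.map_injective Subtype.val_injective
    rw [← IsNilpotent.map_iff hj]
    refine hA.isNilpotent_matrix hK _ fun k l => ?_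
    have : j.mapMatrix Z k l ∈ 𝒜 1 := by
      change ((Z k l : B) : A) ∈ 𝒜 1
      have e : Z k l = ∑ x, U₀ k x * (X - i.mapMatrix X₀) x l := Matrix.mul_apply
      rw [e, AddSubmonoidClass.coe_finsetSum]
      refine sum_mem fun x _ => ?_
      have h1 : ((U₀ k x : B) : A) ∈ 𝒜 0 := (X₀.adjugate k x).2
      have h2 : (((X - i.mapMatrix X₀) x l : B) : A) ∈ 𝒜 1 := by
        have : (X - i.mapMatrix X₀) x l = hB.proj 1 (X x l) := by
          change X x l - hB.proj 0 (X x l) = _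
          rw [sub_eq_iff_eq_add', hB.proj_add_proj]
        rw [this]
        exact proj_mem 𝒜 1 _
      simpa using SetLike.mul_mem_graded h1 h2
    rw [proj_of_mem_ne 𝒜 this (by decide)]
    exact IsNilpotent.zero
  have hUX : U₀ * X = Matrix.scalar ι d - (-Z) := by
    rw [sub_neg_eq_add, ← h0, ← mul_add, add_sub_cancel]
  have hc : Commute (Matrix.scalar ι d) (-Z) :=
    Matrix.scalar_commute d (fun a => Subtype.ext (hA.even_mul hd a)) _
  obtain ⟨m, hm⟩ := hZ
  -- The geometric sum multiplies `d - (-Z)` to `d^m - (-Z)^m = d^m`.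
  refine ⟨(∑ k ∈ Finset.range m, Matrix.scalar ι d ^ k * (-Z) ^ (m - 1 - k)) * U₀, d ^ m, ?_, ?_, ?_⟩
  · have := SetLike.pow_mem_graded m hd
    simpa using this
  · rw [SubmonoidClass.coe_pow, map_pow, hd1, one_pow]
  · rw [mul_assoc, hUX, hc.geom_sum₂_mul, map_pow, neg_pow, hm, mul_zero, sub_zero]

section Nakayama

variable (𝒜 B) (N : Type*) [AddCommGroup N] [Module B N]

/-- The submodule `B⁺ N`, where `B⁺` is the augmentation ideal. -/
def augmentationSubmodule : Submodule B N :=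
  Submodule.span B {x | ∃ (b : B) (n : N), augmentation 𝒜 (b : A) = 0 ∧ x = b • n}

variable {N}

theorem exists_coeff_of_mem_augmentationSubmodule {κ : Type*} [Fintype κ] {g : κ → N}
    (hg : Submodule.span B (Set.range g) = ⊤) {x : N} (hx : x ∈ augmentationSubmodule 𝒜 B N) :
    ∃ m : κ → B, (∀ k, augmentation 𝒜 (m k : A) = 0) ∧ ∑ k, m k • g k = x := by
  induction hx using Submodule.span_induction with
  | mem x hx =>
    obtain ⟨b, n, hb, rfl⟩ := hx
    have hn : n ∈ Submodule.span B (Set.range g) := hg ▸ Submodule.mem_top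
    obtain ⟨c, rfl⟩ := (Submodule.mem_span_range_iff_exists_fun B).1 hn
    exact ⟨fun k => b * c k, fun k => by simp [hb], by simp [mul_smul, Finset.smul_sum]⟩
  | zero => exact ⟨0, by simp, by simp⟩
  | add x y _ _ hx hy =>
    obtain ⟨m, hm, rfl⟩ := hx
    obtain ⟨m', hm', rfl⟩ := hy
    exact ⟨fun k => m k + m' k, fun k => by simp [hm, hm'],
      by simp [add_smul, Finset.sum_add_distrib]⟩
  | smul b x _ hx =>
    obtain ⟨m, hm, rfl⟩ := hx
    exact ⟨fun k => b * m k, fun k => by simp [hm], by simp [mul_smul, Finset.smul_sum]⟩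

variable {𝒜 B}

/-- Nakayama's lemma at the augmentation ideal. -/
theorem exists_smul_mem_of_sup_eq_top (hB : IsHopfSupersubalgebra 𝒜 B)
    (hA : IsSupercommutative 𝒜) (hK : ringChar K ≠ 2) [Module.Finite B N] (Q : Submodule B N)
    (hQ : Q ⊔ augmentationSubmodule 𝒜 B N = ⊤) :
    ∃ b : B, (b : A) ∈ 𝒜 0 ∧ augmentation 𝒜 (b : A) = 1 ∧ ∀ x : N, b • x ∈ Q := by
  obtain ⟨s, g, hg⟩ := Module.Finite.exists_fin (R := B) (M := N)
  -- The determinant trick: `1 - M` sends the generators into `Q` and reduces to the identity at the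
  -- augmentation, so it has a left inverse up to an even scalar of augmentation one.
  have h1 : ∀ k, ∃ m : Fin s → B, (∀ l, augmentation 𝒜 (m l : A) = 0) ∧
      g k - ∑ l, m l • g l ∈ Q := by
    intro k
    have hk : g k ∈ Q ⊔ augmentationSubmodule 𝒜 B N := hQ ▸ Submodule.mem_top
    obtain ⟨y, hy, z, hz, e⟩ := Submodule.mem_sup.1 hk
    obtain ⟨m, hm, rfl⟩ := exists_coeff_of_mem_augmentationSubmodule 𝒜 B hg hz
    exact ⟨m, hm, by rwa [← e, add_sub_cancel_right]⟩
  choose M hM hMQ using h1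
  obtain ⟨U, b, hb, hb1, hU⟩ := hB.exists_mul_eq_scalar hA hK (1 - Matrix.of M) (by
    ext k l
    by_cases hkl : k = l <;> simp [hkl, hM, Matrix.one_apply])
  have hgk : ∀ k, b • g k ∈ Q := by
    intro k
    have e1 : ∀ j, ∑ l, (1 - Matrix.of M) j l • g l = g j - ∑ l, M j l • g l := by
      intro j
      simp only [Matrix.sub_apply, Matrix.of_apply, sub_smul, Finset.sum_sub_distrib,
        Matrix.one_apply, ite_smul, one_smul, zero_smul, Finset.sum_ite_eq, Finset.mem_univ,
        if_true]
    have e2 : b • g k = ∑ j, U k j • ∑ l, (1 - Matrix.of M) j l • g l := by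
      have : ∑ l, (Matrix.scalar (Fin s) b) k l • g l = b • g k := by
        simp [Matrix.scalar_apply, Matrix.diagonal_apply, ite_smul]
      rw [← this, ← hU]
      simp only [Matrix.mul_apply, Finset.sum_smul, Finset.smul_sum, mul_smul]
      exact Finset.sum_comm
    rw [e2]
    exact sum_mem fun j _ => Q.smul_mem _ (e1 j ▸ hMQ j)
  refine ⟨b, hb, hb1, fun x => ?_⟩
  have hx : x ∈ Submodule.span B (Set.range g) := hg ▸ Submodule.mem_top
  obtain ⟨c, rfl⟩ := (Submodule.mem_span_range_iff_exists_fun B).1 hx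
  rw [Finset.smul_sum]
  refine sum_mem fun k _ => ?_
  rw [smul_smul, show b * c k = c k * b from Subtype.ext (hA.even_mul hb _), mul_smul]
  exact Q.smul_mem _ (hgk k)

end Nakayama

end IsHopfSupersubalgebra

/-! ### Projectivity near the augmentation -/

namespace IsHopfSupersubalgebra

open IsSupercommutative HopfSuperalgebra

variable {K : Type u} [Field K] {A : Type v} [Ring A] [Algebra K A] [Coalgebra K A]
  {𝒜 : ZMod 2 → Submodule K A} [GradedAlgebra 𝒜] [HopfSuperalgebra K 𝒜] {B : Subalgebra K A}

section Slice

variable {N : Type*} [AddCommGroup N] [Module K N]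

/-- The map `A ⊗ N → A`, `a ⊗ n ↦ ω(n) a` given by a functional `ω` on `N`. -/
noncomputable def contract (ω : N →ₗ[K] K) : A ⊗[K] N →ₗ[K] A :=
  (TensorProduct.rid K A).toLinearMap ∘ₗ LinearMap.lTensor A ω

omit [Coalgebra K A] in
theorem contract_tmul (ω : N →ₗ[K] K) (a : A) (n : N) : contract ω (a ⊗ₜ n) = ω n • a := by
  simp [contract]

variable [Module B N] [IsScalarTower K B N]

/-- The signed term of the action involves the odd part of `b`, on which the augmentation, and hence
`ω`, vanishes. -/
theorem contract_act (hB : IsHopfSupersubalgebra 𝒜 B) {ω : N →ₗ[K] K}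
    (hω : ∀ (b : B) n, ω (b • n) = augmentation 𝒜 (b : A) * ω n) (t : A ⊗[K] B) (s : A ⊗[K] N) :
    contract ω (hB.act N t s) =
      contract (Coalgebra.counit ∘ₗ B.val.toLinearMap) t * contract ω s := by
  induction t with
  | zero => simp
  | add t t' h h' => simp only [map_add, LinearMap.add_apply, h, h', add_mul]
  | tmul a b =>
    induction s with
    | zero => simp
    | add s s' h h' => simp only [map_add, h, h', mul_add]
    | tmul a' n =>
      rw [act_tmul, map_add, contract_tmul, contract_tmul, contract_tmul, contract_tmul, hω, hω,
        coe_proj, coe_proj, augmentation_odd (proj_mem 𝒜 1 _), augmentation_proj_zero, zero_mul,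
        zero_smul, add_zero, smul_mul_smul_comm]
      rfl

theorem contract_comul (hB : IsHopfSupersubalgebra 𝒜 B) (b : B) :
    contract (Coalgebra.counit ∘ₗ B.val.toLinearMap) (hB.comul b) = (b : A) := by
  rw [contract, LinearMap.comp_apply, LinearMap.lTensor_comp, LinearMap.comp_apply,
    lTensor_val_comul]
  simp

/-- The left `B`-linear map `N → A`, `n ↦ n₍₋₁₎ ω(n₍₀₎)` given by a functional on `N / B⁺ N`. -/
noncomputable def coefficient {hB : IsHopfSupersubalgebra 𝒜 B} {ρ : N →ₗ[K] A ⊗[K] N}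
    (h : hB.IsHopfModule ρ) (ω : N →ₗ[K] K)
    (hω : ∀ (b : B) n, ω (b • n) = augmentation 𝒜 (b : A) * ω n) : N →ₗ[B] A where
  toFun n := contract ω (ρ n)
  map_add' := by simp
  map_smul' b n := by
    rw [h.map_smul, hB.contract_act hω, contract_comul]
    rfl

-- In Sweedler notation, `S(n₍₋₂₎) n₍₋₁₎ ω(n₍₀₎) = ε(n₍₋₁₎) ω(n₍₀₎) = ω(n)`. This recovers the
-- functional from its coefficient map and is the source of the left inverse of the coefficient
-- matrix.
variable (𝒜) in
theorem antipode_coefficient {hB : IsHopfSupersubalgebra 𝒜 B} {ρ : N →ₗ[K] A ⊗[K] N}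
    (h : hB.IsHopfModule ρ) (ω : N →ₗ[K] K) (n : N) :
    LinearMap.mul' K A (TensorProduct.map (antipode 𝒜) (contract ω ∘ₗ ρ) (ρ n)) =
      algebraMap K A (ω n) := by
  have key : ∀ t : A ⊗[K] N, LinearMap.mul' K A (TensorProduct.map (antipode 𝒜) (contract ω)
      (TensorProduct.assoc K A A N (LinearMap.rTensor N Coalgebra.comul t))) =
      algebraMap K A (ω (TensorProduct.lid K N (LinearMap.rTensor N Coalgebra.counit t))) := by
    intro t
    induction t with
    | zero => simp
    | add s s' h h' => simp only [map_add, h, h']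
    | tmul a n =>
      have e : ∀ s : A ⊗[K] A, LinearMap.mul' K A (TensorProduct.map (antipode 𝒜) (contract ω)
          (TensorProduct.assoc K A A N (s ⊗ₜ n))) =
          ω n • LinearMap.mul' K A (LinearMap.rTensor A (antipode 𝒜) s) := by
        intro s
        induction s with
        | zero => simp
        | add s s' h h' => simp only [map_add, TensorProduct.add_tmul, h, h', smul_add]
        | tmul x y => simp [contract_tmul]
      have e2 := LinearMap.congr_fun (mul_antipode_rTensor_comul (𝒜 := 𝒜)) a
      simp only [LinearMap.comp_apply] at e2
      rw [LinearMap.rTensor_tmul, e, e2, LinearMap.rTensor_tmul, TensorProduct.lid_tmul, map_smul,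
        smul_eq_mul, mul_comm, map_mul, Algebra.smul_def]
      rfl
  have := key (ρ n)
  rw [h.counit, h.coassoc, ← LinearMap.comp_apply (TensorProduct.map _ _),
    LinearMap.map_comp_lTensor] at this
  exact this

end Slice

/-- A finitely generated Hopf module is projective near the augmentation: an even element of
augmentation one acts on it as a sum of endomorphisms factoring through `B`. -/
theorem exists_factor_near_augmentation {hB : IsHopfSupersubalgebra 𝒜 B}
    (hA : IsSupercommutative 𝒜) (hK : ringChar K ≠ 2) {N : Type*} [AddCommGroup N] [Module K N]
    [Module B N] [IsScalarTower K B N] [Module.Finite B N] {ρ : N →ₗ[K] A ⊗[K] N}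
    (h : hB.IsHopfModule ρ) :
    ∃ (b : B) (r : ℕ) (φ : Fin r → N →ₗ[B] B) (n : Fin r → N), (b : A) ∈ 𝒜 0 ∧
      augmentation 𝒜 (b : A) = 1 ∧ ∀ x, b • x = ∑ i, φ i x • n i := by
  classical
  let P := augmentationSubmodule 𝒜 B N
  -- `b - ε(b)` lies in `B⁺`, so `B` acts on the quotient through the augmentation and finite
  -- generation over `B` gives finite dimension over `K`.
  have hπ : ∀ (b : B) (x : N), P.mkQ (b • x) = augmentation 𝒜 (b : A) • P.mkQ x := by
    intro b x
    have e : b • x = (augmentation 𝒜 (b : A)) • x +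
        (b - algebraMap K B (augmentation 𝒜 (b : A))) • x := by
      rw [sub_smul, algebraMap_smul]
      abel
    have hm : (b - algebraMap K B (augmentation 𝒜 (b : A))) • x ∈ P :=
      Submodule.subset_span ⟨_, x, by
        rw [Subalgebra.coe_sub, map_sub, sub_eq_zero, Subalgebra.coe_algebraMap, AlgHom.commutes]
        rfl, rfl⟩
    have h0 : P.mkQ ((b - algebraMap K B (augmentation 𝒜 (b : A))) • x) = 0 :=
      (Submodule.Quotient.mk_eq_zero P).2 hm
    rw [e, map_add, h0, add_zero]
    rfl
  obtain ⟨s, g, hg⟩ := Module.Finite.exists_fin (R := B) (M := N)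
  have hfin : Module.Finite K (N ⧸ P) := by
    refine ⟨⟨Finset.univ.image fun k => P.mkQ (g k), ?_⟩⟩
    rw [Finset.coe_image, Finset.coe_univ, Set.image_univ, eq_top_iff]
    rintro y -
    obtain ⟨x, rfl⟩ := P.mkQ_surjective y
    have hx : x ∈ Submodule.span B (Set.range g) := hg ▸ Submodule.mem_top
    obtain ⟨c, rfl⟩ := (Submodule.mem_span_range_iff_exists_fun B).1 hx
    rw [map_sum]
    refine sum_mem fun k _ => ?_
    rw [hπ]
    exact Submodule.smul_mem _ _ (Submodule.subset_span ⟨k, rfl⟩)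
  let r := Module.finrank K (N ⧸ P)
  let w := Module.finBasis K (N ⧸ P)
  choose n hn using fun i => P.mkQ_surjective (w i)
  let ω : Fin r → N →ₗ[K] K := fun j => w.coord j ∘ₗ P.mkQ.restrictScalars K
  have hω : ∀ j (b : B) x, ω j (b • x) = augmentation 𝒜 (b : A) * ω j x := by
    intro j b x
    change w.coord j (P.mkQ (b • x)) = _
    rw [hπ, map_smul]
    rfl
  have hωn : ∀ i j, ω j (n i) = if i = j then 1 else 0 := by
    intro i j
    change w.coord j (P.mkQ (n i)) = _
    rw [hn, Module.Basis.coord_apply, Module.Basis.repr_self, Finsupp.single_apply]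
  have hQ : Submodule.span B (Set.range n) ⊔ augmentationSubmodule 𝒜 B N = ⊤ := by
    rw [eq_top_iff]
    rintro x -
    have e : P.mkQ x = P.mkQ (∑ i, algebraMap K B (w.repr (P.mkQ x) i) • n i) := by
      conv_lhs => rw [← w.sum_repr (P.mkQ x)]
      rw [map_sum]
      refine Finset.sum_congr rfl fun i _ => ?_
      rw [hπ, hn, Subalgebra.coe_algebraMap, AlgHom.commutes]
      rfl
    rw [← sub_eq_zero, ← map_sub] at e
    have e' := (Submodule.Quotient.mk_eq_zero P).1 e
    rw [← add_sub_cancel (∑ i, algebraMap K B (w.repr (P.mkQ x) i) • n i) x]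
    exact Submodule.add_mem_sup
      (sum_mem fun i _ => Submodule.smul_mem _ _ (Submodule.subset_span ⟨i, rfl⟩)) e'
  obtain ⟨b, hb, hb1, hbQ⟩ := hB.exists_smul_mem_of_sup_eq_top hA hK _ hQ
  let L : Fin r → N →ₗ[B] A := fun j => coefficient h (ω j) (hω j)
  let X : Matrix (Fin r) (Fin r) A := fun i l => L l (n i)
  -- The coefficients `c` are not unique; the coefficient maps `L l` constrain them through the
  -- matrix `X`.
  have hL : ∀ x, ∃ c : Fin r → B, b • x = ∑ i, c i • n i ∧
      ∀ l, (b : A) * L l x = ∑ i, (c i : A) * X i l := by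
    intro x
    obtain ⟨c, hc⟩ := (Submodule.mem_span_range_iff_exists_fun B).1 (hbQ x)
    refine ⟨c, hc.symm, fun l => ?_⟩
    have := congrArg (L l) hc
    rw [map_smul, map_sum] at this
    simp only [map_smul] at this
    exact this.symm
  -- Since `b` is central it moves past the antipode factor, and `b L_l(x)` is a combination of the
  -- entries of `X`. With `t = ρ (n j)` the left side is `b` times the Kronecker delta, so `Y X =
  -- b`.
  have hY : ∀ t : A ⊗[K] N, ∃ y : Fin r → A, ∀ l, (b : A) *
      LinearMap.mul' K A (TensorProduct.map (antipode 𝒜) (contract (ω l) ∘ₗ ρ) t) =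
        ∑ i, y i * X i l := by
    intro t
    induction t with
    | zero => exact ⟨0, by simp⟩
    | add t t' ht ht' =>
      obtain ⟨y, hy⟩ := ht
      obtain ⟨y', hy'⟩ := ht'
      exact ⟨y + y', fun l => by
        simp only [map_add, mul_add, hy, hy', Pi.add_apply, add_mul, Finset.sum_add_distrib]⟩
    | tmul a x =>
      obtain ⟨c, -, hc⟩ := hL x
      refine ⟨fun i => antipode 𝒜 a * c i, fun l => ?_⟩
      simp only [mul_assoc, ← Finset.mul_sum, ← hc]
      rw [TensorProduct.map_tmul, LinearMap.mul'_apply, ← mul_assoc, hA.even_mul hb, mul_assoc]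
      rfl
  choose Y hY using fun j => hY (ρ (n j))
  have hYX : (Matrix.of Y) * X = Matrix.scalar (Fin r) (b : A) := by
    ext j l
    rw [Matrix.mul_apply, Matrix.scalar_apply, Matrix.diagonal_apply]
    simp only [Matrix.of_apply]
    rw [← hY, antipode_coefficient 𝒜 h, hωn]
    split_ifs <;> simp
  obtain ⟨k, hk⟩ := hA.exists_pow_mul_comm hK X (Matrix.of Y) hb hYX
  have hbp : ∀ m : ℕ, (b : A) ^ m ∈ 𝒜 0 := fun m => by simpa using SetLike.pow_mem_graded m hb
  have hXY : ∀ i j, (b : A) ^ k * ∑ l, X i l * Y l j = if i = j then (b : A) ^ (k + 1) else 0 := by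
    intro i j
    have := congrFun (congrFun hk i) j
    rw [← map_pow, ← map_pow, Matrix.scalar_apply, Matrix.scalar_apply, Matrix.diagonal_mul,
      Matrix.diagonal_apply, Matrix.mul_apply] at this
    exact this
  -- This formula is linear in `x` but only visibly `A`-valued. One factor `b` turns `L` into `cX`,
  -- and `b^k` turns `XY` into a scalar, so the value is `c j * b^(k+1)`, which lies in `B` for
  -- every choice of `c`.
  let ψ : Fin r → N →ₗ[B] A := fun j =>
    { toFun := fun x => (∑ l, L l x * Y l j) * (b : A) ^ (k + 1)
      map_add' := fun x x' => by simp [add_mul, Finset.sum_add_distrib]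
      map_smul' := fun c x => by
        simp [Finset.mul_sum, Finset.sum_mul, Subalgebra.smul_def, mul_assoc] }
  have hψ : ∀ x (c : Fin r → B), (∀ l, (b : A) * L l x = ∑ i, (c i : A) * X i l) →
      ∀ j, ψ j x = ((c j * b ^ (k + 1) : B) : A) := by
    intro x c hc j
    change (∑ l, L l x * Y l j) * (b : A) ^ (k + 1) = _
    rw [← hA.even_mul (hbp _), pow_succ, mul_assoc, Finset.mul_sum]
    simp only [← mul_assoc (b : A), hc, Finset.sum_mul]
    rw [Finset.sum_comm, Finset.mul_sum]
    have : ∀ i, (b : A) ^ k * ∑ l, (c i : A) * X i l * Y l j =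
        c i * (if i = j then (b : A) ^ (k + 1) else 0) := by
      intro i
      rw [← hXY]
      simp only [mul_assoc, ← Finset.mul_sum]
      rw [← mul_assoc, hA.even_mul (hbp k), mul_assoc]
    simp [this]
  have hmem : ∀ j x, ψ j x ∈ B := by
    intro j x
    obtain ⟨c, -, hc⟩ := hL x
    rw [hψ x c hc]
    exact SetLike.coe_mem _
  let φ : Fin r → N →ₗ[B] B := fun j =>
    { toFun := fun x => ⟨ψ j x, hmem j x⟩
      map_add' := fun x x' => Subtype.ext (map_add (ψ j) x x')
      map_smul' := fun c x => Subtype.ext (map_smul (ψ j) c x) }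
  refine ⟨b ^ (k + 1) * b, r, φ, n, ?_, ?_, fun x => ?_⟩
  · rw [← pow_succ]
    exact hbp _
  · simp [hb1]
  · obtain ⟨c, hcx, hc⟩ := hL x
    have : ∀ j, φ j x = b ^ (k + 1) * c j := fun j => Subtype.ext <| by
      refine (hψ x c hc j).trans ?_
      rw [Subalgebra.coe_mul, Subalgebra.coe_mul]
      exact (hA.even_mul (hbp (k + 1)) _).symm
    simp only [this, mul_smul, ← Finset.smul_sum]
    rw [hcx]

end IsHopfSupersubalgebra

/-! ### The antipode followed by a map to a commutative algebra -/

namespace HopfSuperalgebra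

open IsSupercommutative

variable {K : Type u} [Field K] {A : Type v} [Ring A] [Algebra K A] [Coalgebra K A]
  {𝒜 : ZMod 2 → Submodule K A} [GradedAlgebra 𝒜] [HopfSuperalgebra K 𝒜]
  {C : Type*} [CommRing C] [Algebra K C]

omit [Coalgebra K A] [HopfSuperalgebra K 𝒜] in
theorem map_proj_zero_of_odd {q : A →ₐ[K] C} (hq : ∀ a ∈ 𝒜 1, q a = 0) (a : A) :
    q (GradedAlgebra.proj 𝒜 0 a) = q a := by
  conv_rhs => rw [← IsSupercommutative.proj_add_proj 𝒜 a, map_add, hq _ (proj_mem 𝒜 1 a), add_zero]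

omit [Coalgebra K A] [HopfSuperalgebra K 𝒜] in
theorem map_parity_of_odd {q : A →ₐ[K] C} (hq : ∀ a ∈ 𝒜 1, q a = 0) (a : A) :
    q (parity 𝒜 a) = q a := by
  rw [parity, LinearMap.sub_apply, map_sub, hq _ (proj_mem 𝒜 1 a), sub_zero,
    map_proj_zero_of_odd hq]

theorem mul_map_antipode_left (q : A →ₐ[K] C) (a : A) :
    LinearMap.mul' K C (TensorProduct.map (q.toLinearMap ∘ₗ antipode 𝒜) q.toLinearMap
      (Coalgebra.comul a)) = algebraMap K C (Coalgebra.counit a) := by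
  have e : ∀ s : A ⊗[K] A, LinearMap.mul' K C (TensorProduct.map (q.toLinearMap ∘ₗ antipode 𝒜)
      q.toLinearMap s) = q (LinearMap.mul' K A (LinearMap.rTensor A (antipode 𝒜) s)) := by
    intro s
    induction s with
    | zero => simp
    | add s s' h h' => simp only [map_add, h, h']
    | tmul x y => simp
  have e2 := LinearMap.congr_fun (mul_antipode_rTensor_comul (𝒜 := 𝒜)) a
  simp only [LinearMap.comp_apply] at e2
  rw [e, e2]
  exact q.commutes _

theorem mul_map_antipode_right (q : A →ₐ[K] C) (a : A) :
    LinearMap.mul' K C (TensorProduct.map q.toLinearMap (q.toLinearMap ∘ₗ antipode 𝒜)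
      (Coalgebra.comul a)) = algebraMap K C (Coalgebra.counit a) := by
  have e : ∀ s : A ⊗[K] A, LinearMap.mul' K C (TensorProduct.map q.toLinearMap
      (q.toLinearMap ∘ₗ antipode 𝒜) s) =
        q (LinearMap.mul' K A (LinearMap.lTensor A (antipode 𝒜) s)) := by
    intro s
    induction s with
    | zero => simp
    | add s s' h h' => simp only [map_add, h, h']
    | tmul x y => simp
  have e2 := LinearMap.congr_fun (mul_antipode_lTensor_comul (𝒜 := 𝒜)) a
  simp only [LinearMap.comp_apply] at e2
  rw [e, e2]
  exact q.commutes _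

theorem comul_one_eq (𝒜 : ZMod 2 → Submodule K A) [GradedAlgebra 𝒜] [HopfSuperalgebra K 𝒜] : Coalgebra.comul (R := K) (1 : A) = 1 ⊗ₜ 1 :=
  (GradedTensorProduct.of K 𝒜 𝒜).injective (HopfSuperalgebra.comul_one (𝒜 := 𝒜))

variable (𝒜) in
theorem antipode_one : antipode 𝒜 (1 : A) = 1 := by
  have e2 := LinearMap.congr_fun (mul_antipode_rTensor_comul (𝒜 := 𝒜)) 1
  simp only [LinearMap.comp_apply, comul_one_eq 𝒜, counit_one 𝒜] at e2
  simpa using e2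

-- Uniqueness of convolution inverses on `A ⊗ A`: both sides are inverse to `q` composed with
-- multiplication, one from the left and one from the right.
open WithConv in
theorem map_antipode_mul {q : A →ₐ[K] C} (hq : ∀ a ∈ 𝒜 1, q a = 0) (a b : A) :
    q (antipode 𝒜 (a * b)) = q (antipode 𝒜 a) * q (antipode 𝒜 b) := by
  let q' : A →ₗ[K] C := q.toLinearMap ∘ₗ antipode 𝒜
  let F : WithConv (A ⊗[K] A →ₗ[K] C) := toConv (q' ∘ₗ LinearMap.mul' K A)
  let Q : WithConv (A ⊗[K] A →ₗ[K] C) := toConv (q.toLinearMap ∘ₗ LinearMap.mul' K A)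
  let G : WithConv (A ⊗[K] A →ₗ[K] C) := toConv (LinearMap.mul' K C ∘ₗ TensorProduct.map q' q')
  have hF : F * Q = 1 := by
    have hom : ∀ (i j : ZMod 2) (a a' b c : A), b ∈ 𝒜 i → a' ∈ 𝒜 j →
        GradedTensorProduct.of K 𝒜 𝒜 (a ⊗ₜ b) * GradedTensorProduct.of K 𝒜 𝒜 (a' ⊗ₜ c) =
        (-1 : ℤˣ) ^ (i * j) • GradedTensorProduct.of K 𝒜 𝒜 ((a * a') ⊗ₜ (b * c)) :=
      fun i j a a' b c hb ha' =>
        GradedTensorProduct.tmul_coe_mul_coe_tmul 𝒜 𝒜 a (⟨b, hb⟩ : 𝒜 i) (⟨a', ha'⟩ : 𝒜 j) c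
    let Θ : GradedTensorProduct K 𝒜 𝒜 →ₗ[K] C := LinearMap.mul' K C ∘ₗ
      TensorProduct.map q' q.toLinearMap ∘ₗ (GradedTensorProduct.of K 𝒜 𝒜).symm.toLinearMap
    have hΘ : ∀ x y : A, Θ (GradedTensorProduct.of K 𝒜 𝒜 (x ⊗ₜ y)) = q' x * q y := by
      intro x y
      simp [Θ]
    -- The convolution product uses the unsigned coalgebra `A ⊗ A`, while `comul_mul` uses signs.
    -- They agree here: a sign needs `a'` odd, and then `q (a' * b') = 0`.
    have key : ∀ s t : A ⊗[K] A, LinearMap.mul' K C (TensorProduct.map F.ofConv Q.ofConv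
        (TensorProduct.tensorTensorTensorComm K A A A A (s ⊗ₜ t))) =
        Θ (GradedTensorProduct.of K 𝒜 𝒜 s * GradedTensorProduct.of K 𝒜 𝒜 t) := by
      intro s t
      induction s with
      | zero => simp
      | add s s' h h' => simp only [map_add, TensorProduct.add_tmul, h, h', add_mul]
      | tmul a a' =>
        induction t with
        | zero => simp
        | add s s' h h' => simp only [map_add, TensorProduct.tmul_add, h, h', mul_add]
        | tmul b b' =>
          have e1 : (a ⊗ₜ[K] a' : A ⊗[K] A) =
              a ⊗ₜ (GradedAlgebra.proj 𝒜 0 a') + a ⊗ₜ (GradedAlgebra.proj 𝒜 1 a') := by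
            rw [← TensorProduct.tmul_add, IsSupercommutative.proj_add_proj]
          have e2 : (b ⊗ₜ[K] b' : A ⊗[K] A) =
              (GradedAlgebra.proj 𝒜 0 b) ⊗ₜ b' + (GradedAlgebra.proj 𝒜 1 b) ⊗ₜ b' := by
            rw [← TensorProduct.add_tmul, IsSupercommutative.proj_add_proj]
          have e3 : a * b = a * GradedAlgebra.proj 𝒜 0 b + a * GradedAlgebra.proj 𝒜 1 b := by
            rw [← mul_add, IsSupercommutative.proj_add_proj]
          rw [TensorProduct.tensorTensorTensorComm_tmul, TensorProduct.map_tmul,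
            LinearMap.mul'_apply]
          change q' (a * b) * q (a' * b') = _
          rw [e3, e1, e2]
          simp only [map_add, add_mul, mul_add,
            hom 0 0 _ _ _ _ (proj_mem 𝒜 0 _) (proj_mem 𝒜 0 _),
            hom 1 0 _ _ _ _ (proj_mem 𝒜 1 _) (proj_mem 𝒜 0 _),
            hom 0 1 _ _ _ _ (proj_mem 𝒜 0 _) (proj_mem 𝒜 1 _),
            hom 1 1 _ _ _ _ (proj_mem 𝒜 1 _) (proj_mem 𝒜 1 _)]
          simp only [mul_zero, zero_mul, uzpow_zero, one_smul, mul_one, uzpow_one, Units.neg_smul,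
            map_neg, hΘ, map_mul, map_proj_zero_of_odd hq, hq _ (proj_mem 𝒜 1 _)]
          ring
    apply WithConv.ext
    refine TensorProduct.ext' fun a b => ?_
    rw [LinearMap.convMul_def]
    change LinearMap.mul' K C (TensorProduct.map F.ofConv Q.ofConv
      (Coalgebra.comul (R := K) (a ⊗ₜ b))) = algebraMap K C (Coalgebra.counit (R := K) (a ⊗ₜ b))
    have e5 : Coalgebra.comul (R := K) (a ⊗ₜ[K] b) =
        TensorProduct.tensorTensorTensorComm K A A A A
          (Coalgebra.comul (R := K) a ⊗ₜ Coalgebra.comul (R := K) b) :=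
      TensorProduct.comul_tmul a b
    rw [e5, key, ← comul_mul]
    refine (mul_map_antipode_left q (a * b)).trans ?_
    rw [counit_mul 𝒜, TensorProduct.counit_tmul, smul_eq_mul, mul_comm]
  have hG : Q * G = 1 := by
    have key : ∀ s t : A ⊗[K] A, LinearMap.mul' K C (TensorProduct.map Q.ofConv G.ofConv
        (TensorProduct.tensorTensorTensorComm K A A A A (s ⊗ₜ t))) =
        LinearMap.mul' K C (TensorProduct.map q.toLinearMap q' s) *
        LinearMap.mul' K C (TensorProduct.map q.toLinearMap q' t) := by
      intro s t
      induction s with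
      | zero => simp
      | add s s' h h' => simp only [map_add, TensorProduct.add_tmul, h, h', add_mul]
      | tmul a a' =>
        induction t with
        | zero => simp
        | add s s' h h' => simp only [map_add, TensorProduct.tmul_add, h, h', mul_add]
        | tmul b b' =>
          change q (a * b) * (q' a' * q' b') = q a * q' a' * (q b * q' b')
          rw [map_mul]
          ring
    apply WithConv.ext
    refine TensorProduct.ext' fun a b => ?_
    rw [LinearMap.convMul_def]
    change LinearMap.mul' K C (TensorProduct.map Q.ofConv G.ofConv
      (Coalgebra.comul (R := K) (a ⊗ₜ b))) = algebraMap K C (Coalgebra.counit (R := K) (a ⊗ₜ b))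
    have e5 : Coalgebra.comul (R := K) (a ⊗ₜ[K] b) =
        TensorProduct.tensorTensorTensorComm K A A A A
          (Coalgebra.comul (R := K) a ⊗ₜ Coalgebra.comul (R := K) b) :=
      TensorProduct.comul_tmul a b
    rw [e5, key, mul_map_antipode_right, mul_map_antipode_right, TensorProduct.counit_tmul,
      smul_eq_mul, map_mul, mul_comm]
  have hFG : F = G := left_inv_eq_right_inv hF hG
  have := LinearMap.congr_fun (congrArg WithConv.ofConv hFG) (a ⊗ₜ b)
  exact this

/-- The composition of the antipode with a homomorphism to a commutative algebra that vanishes on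
odd elements is a homomorphism of algebras. -/
def antipodeHom {q : A →ₐ[K] C} (hq : ∀ a ∈ 𝒜 1, q a = 0) : A →ₐ[K] C :=
  AlgHom.ofLinearMap (q.toLinearMap ∘ₗ antipode 𝒜)
    (by simp [antipode_one 𝒜]) (fun a b => map_antipode_mul hq a b)

theorem antipodeHom_odd {q : A →ₐ[K] C} (hq : ∀ a ∈ 𝒜 1, q a = 0) :
    ∀ a ∈ 𝒜 1, antipodeHom hq a = 0 :=
  fun a ha => hq _ (antipode_mem 1 a ha)

end HopfSuperalgebra

/-! ### Slices of tensors -/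

/-- The contraction of the first tensor factor with a functional. -/
noncomputable def TensorProduct.slice {K D V : Type*} [Field K] [AddCommGroup D] [Module K D]
    [AddCommGroup V] [Module K V] (f : D →ₗ[K] K) : D ⊗[K] V →ₗ[K] V :=
  (TensorProduct.lid K V).toLinearMap ∘ₗ LinearMap.rTensor V f

theorem TensorProduct.slice_tmul {K D V : Type*} [Field K] [AddCommGroup D] [Module K D]
    [AddCommGroup V] [Module K V] (f : D →ₗ[K] K) (d : D) (v : V) :
    slice f (d ⊗ₜ[K] v) = f d • v := by
  simp [slice]

/-- If all slices of a tensor in `D ⊗ V` lie in a subspace `I` of `V`, the tensor lies in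
`D ⊗ I`. -/
theorem TensorProduct.mem_range_lTensor_of_slices {K D V : Type*} [Field K] [AddCommGroup D]
    [Module K D] [AddCommGroup V] [Module K V] (I : Submodule K V) (t : D ⊗[K] V)
    (h : ∀ f : D →ₗ[K] K, slice f t ∈ I) :
    t ∈ LinearMap.range (LinearMap.lTensor D I.subtype) := by
  classical
  have hex : Function.Exact (LinearMap.lTensor D I.subtype) (LinearMap.lTensor D I.mkQ) :=
    lTensor_exact D (LinearMap.exact_subtype_mkQ I) I.mkQ_surjective
  rw [LinearMap.mem_range]
  refine (hex t).1 ?_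
  let b := Module.Basis.ofVectorSpace K D
  apply (TensorProduct.equivFinsuppOfBasisLeft (N := V ⧸ I) b).injective
  rw [map_zero]
  ext i
  have e : ∀ s : D ⊗[K] V, TensorProduct.equivFinsuppOfBasisLeft b (LinearMap.lTensor D I.mkQ s) i =
      I.mkQ (slice (b.coord i) s) := by
    intro s
    induction s with
    | zero => simp
    | add s s' h h' => simp only [map_add, Finsupp.add_apply, h, h']
    | tmul x y => simp [slice_tmul]
  rw [e, Finsupp.zero_apply]
  exact (Submodule.Quotient.mk_eq_zero I).2 (h _)

/-! ### Coactions pushed to a commutative algebra -/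

namespace IsHopfSupersubalgebra

open IsSupercommutative HopfSuperalgebra TensorProduct

section BaseChange

variable {K : Type*} [Field K] {C : Type*} [CommRing C] [Algebra K C] {R : Type*} [Ring R]
  [Algebra K R] {N : Type*} [AddCommGroup N] [Module K N]

variable (C N) in
/-- The multiplication map `C ⊗ (C ⊗ N) → C ⊗ N`. -/
noncomputable def collapse : C ⊗[K] (C ⊗[K] N) →ₗ[K] C ⊗[K] N :=
  TensorProduct.lift (Algebra.lsmul K K (C ⊗[K] N) : C →ₐ[K] Module.End K (C ⊗[K] N)).toLinearMap

theorem collapse_tmul (c : C) (s : C ⊗[K] N) : collapse C N (c ⊗ₜ s) = c • s := rfl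

variable [Module R N] [IsScalarTower K R N]

variable (C R N) in
/-- The action of `C ⊗ R` on `C ⊗ N`. -/
noncomputable def baseAct : C ⊗[K] R →ₗ[K] C ⊗[K] N →ₗ[K] C ⊗[K] N :=
  TensorProduct.map₂ (LinearMap.mul K C) (Algebra.lsmul K K N : R →ₐ[K] Module.End K N).toLinearMap

theorem baseAct_tmul (c c' : C) (r : R) (n : N) :
    baseAct C R N (c ⊗ₜ[K] r) (c' ⊗ₜ[K] n) = (c * c') ⊗ₜ[K] (r • n) := rfl

theorem baseAct_self (t s : C ⊗[K] R) : baseAct C R R t s = t * s := by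
  induction t with
  | zero => simp
  | add t t' h h' => simp only [map_add, LinearMap.add_apply, h, h', add_mul]
  | tmul c r =>
    induction s with
    | zero => simp
    | add s s' h h' => simp only [map_add, h, h', mul_add]
    | tmul c' r' => simp [baseAct_tmul]

theorem baseAct_smul_left (c : C) (t : C ⊗[K] R) (s : C ⊗[K] N) :
    baseAct C R N (c • t) s = c • baseAct C R N t s := by
  induction t with
  | zero => simp
  | add t t' h h' => simp only [map_add, LinearMap.add_apply, h, h', smul_add]
  | tmul c' r =>
    induction s with
    | zero => simp
    | add s s' h h' => simp only [map_add, h, h', smul_add]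
    | tmul c'' n => simp [baseAct_tmul, TensorProduct.smul_tmul', mul_assoc]

theorem baseAct_smul_right (c : C) (t : C ⊗[K] R) (s : C ⊗[K] N) :
    baseAct C R N t (c • s) = c • baseAct C R N t s := by
  induction t with
  | zero => simp
  | add t t' h h' => simp only [map_add, LinearMap.add_apply, h, h', smul_add]
  | tmul c' r =>
    induction s with
    | zero => simp
    | add s s' h h' => simp only [map_add, h, h', smul_add]
    | tmul c'' n => simp [baseAct_tmul, TensorProduct.smul_tmul', mul_left_comm]

theorem slice_baseAct_one_tmul (f : C →ₗ[K] K) (t : C ⊗[K] R) (n : N) :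
    slice f (baseAct C R N t (1 ⊗ₜ n)) = slice f t • n := by
  induction t with
  | zero => simp
  | add t t' h h' => simp only [map_add, LinearMap.add_apply, h, h', add_smul]
  | tmul c r => simp [baseAct_tmul, slice_tmul]

theorem slice_baseAct_tmul (f : C →ₗ[K] K) (t : C ⊗[K] R) (c : C) (n : N) :
    slice f (baseAct C R N t (c ⊗ₜ n)) = slice (f ∘ₗ LinearMap.mulRight K c) t • n := by
  induction t with
  | zero => simp
  | add t t' h h' => simp only [map_add, LinearMap.add_apply, h, h', add_smul]
  | tmul c' r => simp [baseAct_tmul, slice_tmul]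

theorem slice_one_tmul_mul (f : C →ₗ[K] K) (r : R) (t : C ⊗[K] R) :
    slice f ((1 ⊗ₜ r) * t) = r * slice f t := by
  induction t with
  | zero => simp
  | add t t' h h' => simp only [map_add, h, h', mul_add]
  | tmul c' r => simp [slice_tmul]

end BaseChange

variable {K : Type u} [Field K] {A : Type v} [Ring A] [Algebra K A] [Coalgebra K A]
  {𝒜 : ZMod 2 → Submodule K A} [GradedAlgebra 𝒜] [HopfSuperalgebra K 𝒜] {B : Subalgebra K A}
  {C : Type*} [CommRing C] [Algebra K C]

section

variable {N : Type*} [AddCommGroup N] [Module K N] [Module B N] [IsScalarTower K B N]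

/-- As `q` kills odd elements it does not see `parity`, so the two terms of `act` recombine and the
signs disappear. -/
theorem rTensor_act (hB : IsHopfSupersubalgebra 𝒜 B) {q : A →ₐ[K] C} (hq : ∀ a ∈ 𝒜 1, q a = 0)
    (t : A ⊗[K] B) (s : A ⊗[K] N) :
    LinearMap.rTensor N q.toLinearMap (hB.act N t s) =
      baseAct C B N (LinearMap.rTensor B q.toLinearMap t)
        (LinearMap.rTensor N q.toLinearMap s) := by
  induction t with
  | zero => simp
  | add t t' h h' => simp only [map_add, LinearMap.add_apply, h, h']
  | tmul a b =>
    induction s with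
    | zero => simp
    | add s s' h h' => simp only [map_add, h, h']
    | tmul a' n =>
      simp only [act_tmul, map_add, LinearMap.rTensor_tmul, AlgHom.toLinearMap_apply, map_mul,
        map_parity_of_odd hq, baseAct_tmul, ← TensorProduct.tmul_add, ← add_smul,
        hB.proj_add_proj]

/-- The pushout of the coaction along a homomorphism `q : A → C`. -/
noncomputable def push (q : A →ₐ[K] C) (ρ : N →ₗ[K] A ⊗[K] N) : N →ₗ[K] C ⊗[K] N :=
  LinearMap.rTensor N q.toLinearMap ∘ₗ ρ

theorem push_smul {hB : IsHopfSupersubalgebra 𝒜 B} {ρ : N →ₗ[K] A ⊗[K] N}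
    (h : hB.IsHopfModule ρ) {q : A →ₐ[K] C} (hq : ∀ a ∈ 𝒜 1, q a = 0) (b : B) (n : N) :
    push q ρ (b • n) = baseAct C B N (push q hB.comul b) (push q ρ n) := by
  rw [push, LinearMap.comp_apply, h.map_smul, hB.rTensor_act hq]
  rfl

theorem push_mul (hB : IsHopfSupersubalgebra 𝒜 B) {q : A →ₐ[K] C} (hq : ∀ a ∈ 𝒜 1, q a = 0)
    (b c : B) : push q hB.comul (b * c) = push q hB.comul b * push q hB.comul c := by
  rw [← baseAct_self]
  exact push_smul hB.isHopfModule_comul hq b c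

/-- The `C`-linear extension of a pushed coaction is translation of `C ⊗ N` by a point of `A` in
`C`; convolution-inverse points give translations that cancel. -/
theorem collapse_push {hB : IsHopfSupersubalgebra 𝒜 B} {ρ : N →ₗ[K] A ⊗[K] N}
    (h : hB.IsHopfModule ρ) {q q' : A →ₐ[K] C}
    (hqq : ∀ a, LinearMap.mul' K C (TensorProduct.map q.toLinearMap q'.toLinearMap
      (Coalgebra.comul a)) = algebraMap K C (Coalgebra.counit a)) (n : N) :
    collapse C N (TensorProduct.map q.toLinearMap (push q' ρ) (ρ n)) = 1 ⊗ₜ n := by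
  have key : ∀ t : A ⊗[K] N, collapse C N (TensorProduct.map q.toLinearMap
      (LinearMap.rTensor N q'.toLinearMap)
      (TensorProduct.assoc K A A N (LinearMap.rTensor N Coalgebra.comul t))) =
      1 ⊗ₜ TensorProduct.lid K N (LinearMap.rTensor N Coalgebra.counit t) := by
    intro t
    induction t with
    | zero => simp
    | add s s' h h' => simp only [map_add, h, h', TensorProduct.tmul_add]
    | tmul a n =>
      have e : ∀ s : A ⊗[K] A, collapse C N (TensorProduct.map q.toLinearMap
          (LinearMap.rTensor N q'.toLinearMap) (TensorProduct.assoc K A A N (s ⊗ₜ n))) =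
          LinearMap.mul' K C (TensorProduct.map q.toLinearMap q'.toLinearMap s) ⊗ₜ n := by
        intro s
        induction s with
        | zero => simp
        | add s s' h h' => simp only [map_add, TensorProduct.add_tmul, h, h']
        | tmul x y => simp [collapse_tmul, TensorProduct.smul_tmul']
      rw [LinearMap.rTensor_tmul, e, hqq, LinearMap.rTensor_tmul, TensorProduct.lid_tmul,
        TensorProduct.tmul_smul, TensorProduct.smul_tmul', Algebra.algebraMap_eq_smul_one]
  have := key (ρ n)
  rw [h.counit, h.coassoc, ← LinearMap.comp_apply (TensorProduct.map _ _),
    LinearMap.map_comp_lTensor] at this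
  exact this

end

/-! ### Endomorphisms factoring through `B` -/

section Trace

variable (K B) (N : Type*) [AddCommGroup N] [Module K N] [Module B N] [IsScalarTower K B N]

/-- The span of the endomorphisms of `N` that factor through `B`. -/
def factorSpan : Submodule K (N →ₗ[K] N) :=
  Submodule.span K {F | ∃ (φ : N →ₗ[B] B) (m : N), ∀ x, F x = φ x • m}

variable {N} in
/-- Multiplication by an element of `B`, as a `K`-linear map. -/
def mulEnd : B →ₗ[K] N →ₗ[K] N := (Algebra.lsmul K K N : B →ₐ[K] Module.End K N).toLinearMap

variable {K B N}

omit [Coalgebra K A] in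
theorem mulEnd_apply (b : B) (x : N) : mulEnd K B b x = b • x := rfl

-- Endomorphisms that lift through the map `p` from a free module form a subspace, and `x ↦ φ(x) m`
-- lifts by lifting `m`. Lifting the identity splits `p`.
omit [Coalgebra K A] in
theorem projective_of_id_mem (h : (LinearMap.id : N →ₗ[K] N) ∈ factorSpan K B N) :
    Module.Projective B N := by
  refine Module.Projective.of_lifting_property'' fun p hp => ?_
  have key : ∀ F ∈ factorSpan K B N, ∃ F' : N →ₗ[B] N →₀ B, ∀ x, p (F' x) = F x := by
    intro F hF
    induction hF using Submodule.span_induction with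
    | mem F hF =>
      obtain ⟨φ, m, hF⟩ := hF
      obtain ⟨m', hm'⟩ := hp m
      exact ⟨φ.smulRight m', fun x => by rw [LinearMap.smulRight_apply, map_smul, hm', hF]⟩
    | zero => exact ⟨0, by simp⟩
    | add F G _ _ hF hG =>
      obtain ⟨F', hF⟩ := hF
      obtain ⟨G', hG⟩ := hG
      exact ⟨F' + G', by simp [hF, hG]⟩
    | smul k F _ hF =>
      obtain ⟨F', hF⟩ := hF
      have : SMulCommClass B K N := IsScalarTower.to_smulCommClass'
      exact ⟨F' ∘ₗ (k • LinearMap.id), fun x => by simp [hF]⟩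
  obtain ⟨F', hF'⟩ := key _ h
  exact ⟨F', LinearMap.ext hF'⟩

omit [Coalgebra K A] [HopfSuperalgebra K 𝒜] in
theorem mulEnd_comp_mem (hA : IsSupercommutative 𝒜) {c : B} (hc : (c : A) ∈ 𝒜 0)
    {F : N →ₗ[K] N} (hF : F ∈ factorSpan K B N) : mulEnd K B c ∘ₗ F ∈ factorSpan K B N := by
  induction hF using Submodule.span_induction with
  | mem F hF =>
    obtain ⟨φ, m, hF⟩ := hF
    refine Submodule.subset_span ⟨φ, c • m, fun x => ?_⟩
    rw [LinearMap.comp_apply, hF, mulEnd_apply, smul_smul, smul_smul,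
      show c * φ x = φ x * c from Subtype.ext (hA.even_mul hc _)]
  | zero => simp
  | add F G _ _ hF hG =>
    rw [LinearMap.comp_add]
    exact add_mem hF hG
  | smul k F _ hF =>
    rw [LinearMap.comp_smul]
    exact Submodule.smul_mem _ _ hF

/-- The elements of `B` acting as sums of endomorphisms factoring through `B` are stable under the
coaction obtained from a pair of mutually inverse homomorphisms `A → C`. -/
theorem mulEnd_slice_push_mem {hB : IsHopfSupersubalgebra 𝒜 B} {ρ : N →ₗ[K] A ⊗[K] N}
    (h : hB.IsHopfModule ρ) {q q' : A →ₐ[K] C} (hq : ∀ a ∈ 𝒜 1, q a = 0)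
    (hq' : ∀ a ∈ 𝒜 1, q' a = 0)
    (hqq : ∀ a, LinearMap.mul' K C (TensorProduct.map q.toLinearMap q'.toLinearMap
      (Coalgebra.comul a)) = algebraMap K C (Coalgebra.counit a))
    {b : B} (hb : mulEnd K B b ∈ factorSpan K B N) (f : C →ₗ[K] K) :
    mulEnd K B (slice f (push q' hB.comul b)) ∈ factorSpan K B N := by
  -- `Ψ F` is a slice of the conjugate of `1 ⊗ F` by a translation of `C ⊗ N`. It turns
  -- multiplication by `b` into multiplication by a slice of the pushed comultiplication of `b`, so
  -- it remains to see that it preserves `factorSpan`.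
  let Ψ (F : N →ₗ[K] N) : N →ₗ[K] N := slice f ∘ₗ collapse C N ∘ₗ
    TensorProduct.map q.toLinearMap (push q' ρ ∘ₗ F) ∘ₗ ρ
  have hbF : Ψ (mulEnd K B b) = mulEnd K B (slice f (push q' hB.comul b)) := by
    ext n
    have e : ∀ t : A ⊗[K] N, collapse C N (TensorProduct.map q.toLinearMap
        (push q' ρ ∘ₗ mulEnd K B b) t) = baseAct C B N (push q' hB.comul b)
        (collapse C N (TensorProduct.map q.toLinearMap (push q' ρ) t)) := by
      intro t
      induction t with
      | zero => simp
      | add s s' h h' => simp only [map_add, h, h']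
      | tmul a x =>
        rw [TensorProduct.map_tmul, TensorProduct.map_tmul, collapse_tmul, collapse_tmul,
          baseAct_smul_right, ← push_smul h hq']
        rfl
    simp only [Ψ, LinearMap.comp_apply]
    rw [e, collapse_push h hqq, slice_baseAct_one_tmul]
    rfl
  rw [← hbF]
  clear hbF
  generalize (mulEnd K B b : N →ₗ[K] N) = F at hb
  induction hb using Submodule.span_induction with
  | zero =>
    have : Ψ 0 = 0 := by
      ext
      simp [Ψ]
    rw [this]
    exact zero_mem _
  | add F G _ _ hF hG =>
    have : Ψ (F + G) = Ψ F + Ψ G := by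
      ext n
      simp only [Ψ, LinearMap.comp_add, TensorProduct.map_add_right, LinearMap.comp_apply,
        LinearMap.add_apply, map_add]
    rw [this]
    exact add_mem hF hG
  | smul k F _ hF =>
    have : Ψ (k • F) = k • Ψ F := by
      ext n
      simp only [Ψ, LinearMap.comp_smul, TensorProduct.map_smul_right, LinearMap.comp_apply,
        LinearMap.smul_apply, map_smul]
    rw [this]
    exact Submodule.smul_mem _ _ hF
  | mem F hF =>
    obtain ⟨φ, m, hF⟩ := hF
    let θ : N →ₗ[K] C ⊗[K] B := push q' hB.comul ∘ₗ φ.restrictScalars K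
    let ψ : N →ₗ[K] C ⊗[K] B := collapse C B ∘ₗ TensorProduct.map q.toLinearMap θ ∘ₗ ρ
    have hθ : ∀ (c : B) x, θ (c • x) = push q' hB.comul c * θ x := fun c x => by
      change push q' hB.comul (φ (c • x)) = _
      rw [map_smul, smul_eq_mul, hB.push_mul hq']
      rfl
    -- Conjugating `φ` by the translations on `N` and `B` keeps it `B`-linear: the two translations
    -- of the scalar `c` cancel.
    have hψ : ∀ (c : B) x, ψ (c • x) = (1 ⊗ₜ c) * ψ x := by
      intro c x
      have e : ∀ (t : A ⊗[K] B) (s : A ⊗[K] N),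
          collapse C B (TensorProduct.map q.toLinearMap θ (hB.act N t s)) =
          collapse C B (TensorProduct.map q.toLinearMap (push q' hB.comul) t) *
          collapse C B (TensorProduct.map q.toLinearMap θ s) := by
        intro t s
        induction t with
        | zero => simp
        | add t t' h h' => simp only [map_add, LinearMap.add_apply, h, h', add_mul]
        | tmul a c =>
          induction s with
          | zero => simp
          | add s s' h h' => simp only [map_add, h, h', mul_add]
          | tmul a' x =>
            simp only [act_tmul, map_add, TensorProduct.map_tmul, collapse_tmul,
              AlgHom.toLinearMap_apply, map_mul, map_parity_of_odd hq]
            rw [← smul_add, ← map_add, ← add_smul, hB.proj_add_proj, smul_mul_smul_comm,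
              hθ]
      have e1 : ψ (c • x) = collapse C B (TensorProduct.map q.toLinearMap θ (ρ (c • x))) := rfl
      rw [e1, h.map_smul, e, collapse_push hB.isHopfModule_comul hqq]
      rfl
    have hΨ : ∀ x, Ψ F x = slice f (baseAct C B N (ψ x) (push q' ρ m)) := by
      intro x
      have e : ∀ t : A ⊗[K] N, collapse C N (TensorProduct.map q.toLinearMap (push q' ρ ∘ₗ F) t) =
          baseAct C B N (collapse C B (TensorProduct.map q.toLinearMap θ t)) (push q' ρ m) := by
        intro t
        induction t with
        | zero => simp
        | add s s' h h' => simp only [map_add, h, h', LinearMap.add_apply]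
        | tmul a y =>
          rw [TensorProduct.map_tmul, TensorProduct.map_tmul, collapse_tmul, collapse_tmul,
            baseAct_smul_left, LinearMap.comp_apply, hF, push_smul h hq']
          rfl
      exact congrArg (slice f) (e (ρ x))
    -- A pure tensor `c ⊗ n` yields `x ↦ χ(x) n` with `χ` a slice of `ψ`, which is `B`-linear.
    -- Expanding the pushed coaction of `m` gives finitely many such maps.
    have hs : ∀ s : C ⊗[K] N, ∃ G ∈ factorSpan K B N,
        ∀ x, slice f (baseAct C B N (ψ x) s) = G x := by
      intro s
      induction s with
      | zero => exact ⟨0, zero_mem _, by simp⟩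
      | add s s' hs hs' =>
        obtain ⟨G, hG, e⟩ := hs
        obtain ⟨G', hG', e'⟩ := hs'
        exact ⟨G + G', add_mem hG hG', fun x => by simp only [map_add, e, e', LinearMap.add_apply]⟩
      | tmul c n =>
        let χ : N →ₗ[B] B :=
          { toFun := fun x => slice (f ∘ₗ LinearMap.mulRight K c) (ψ x)
            map_add' := fun x y => by simp only [map_add]
            map_smul' := fun c x => by rw [hψ, slice_one_tmul_mul]; rfl }
        let χK : N →ₗ[K] B := χ.restrictScalars K
        refine ⟨LinearMap.flip (mulEnd K B) n ∘ₗ χK, Submodule.subset_span ⟨χ, n, fun x => rfl⟩,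
          fun x => slice_baseAct_tmul f (ψ x) c n⟩
    obtain ⟨G, hG, e⟩ := hs (push q' ρ m)
    have : Ψ F = G := LinearMap.ext fun x => (hΨ x).trans (e x)
    rw [this]
    exact hG

end Trace

end IsHopfSupersubalgebra

/-! ### Projectivity of finitely generated Hopf modules -/

namespace IsHopfSupersubalgebra

open IsSupercommutative HopfSuperalgebra TensorProduct

variable {K : Type u} [Field K] {A : Type v} [Ring A] [Algebra K A] [Coalgebra K A]
  {𝒜 : ZMod 2 → Submodule K A} [GradedAlgebra 𝒜] [HopfSuperalgebra K 𝒜] {B : Subalgebra K A}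

/-- The comultiplication of an even element has legs of equal parity. Since `q` kills the odd left
legs, only even right legs survive. -/
theorem slice_push_even {C : Type*} [CommRing C] [Algebra K C] (hB : IsHopfSupersubalgebra 𝒜 B)
    {q : A →ₐ[K] C} (hq : ∀ a ∈ 𝒜 1, q a = 0) {b : B} (hb : (b : A) ∈ 𝒜 0) (f : C →ₗ[K] K) :
    ((slice f (push q hB.comul b) : B) : A) ∈ 𝒜 0 := by
  have e : ∀ t : A ⊗[K] B, ((slice f (LinearMap.rTensor B q.toLinearMap t) : B) : A) =
      slice (f ∘ₗ q.toLinearMap) (LinearMap.lTensor A B.val.toLinearMap t) := by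
    intro t
    induction t with
    | zero => simp
    | add s s' h h' => simp only [map_add, h, h', Subalgebra.coe_add]
    | tmul a x => simp [slice_tmul]
  have h1 : tensorSquareGrading 𝒜 0 ≤ (𝒜 0).comap (slice (f ∘ₗ q.toLinearMap)) := by
    refine iSup_le fun j => ?_
    rintro _ ⟨t, rfl⟩
    rw [Submodule.mem_comap]
    induction t with
    | zero => simp
    | add s s' h h' =>
      rw [map_add, map_add]
      exact add_mem h h'
    | tmul a x =>
      rw [TensorProduct.mapIncl, TensorProduct.map_tmul, slice_tmul]
      fin_cases j
      · exact (𝒜 0).smul_mem _ x.2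
      · have : q (a : A) = 0 := hq _ a.2
        simp [this]
  rw [push, LinearMap.comp_apply, e, lTensor_val_comul]
  exact h1 (HopfSuperalgebra.comul_mem 0 _ hb)

/-- Finitely generated relative Hopf modules are projective. -/
theorem IsHopfModule.projective {hB : IsHopfSupersubalgebra 𝒜 B} (hA : IsSupercommutative 𝒜)
    (hK : ringChar K ≠ 2) {N : Type*} [AddCommGroup N] [Module K N] [Module B N]
    [IsScalarTower K B N] [Module.Finite B N] {ρ : N →ₗ[K] A ⊗[K] N} (h : hB.IsHopfModule ρ) :
    Module.Projective B N := by
  obtain ⟨b, r, φ, m, hb, hb1, hbφ⟩ := exists_factor_near_augmentation hA hK h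
  obtain ⟨C, _, _, q, hq, hnil⟩ := hA.exists_commutative_quotient hK
  -- An ideal of the even part of `B`; the goal is `1 ∈ I`.
  let I : Submodule K B := (factorSpan K B N).comap (mulEnd K B) ⊓
    (𝒜 0).comap B.val.toLinearMap
  have hmulI : ∀ {c x : B}, (c : A) ∈ 𝒜 0 → x ∈ I → c * x ∈ I := by
    intro c x hc hx
    refine ⟨?_, by simpa using SetLike.mul_mem_graded (A := 𝒜) hc hx.2⟩
    have e : mulEnd K B (c * x) = mulEnd K B c ∘ₗ (mulEnd K B x : N →ₗ[K] N) :=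
      LinearMap.ext fun n => mul_smul c x n
    change mulEnd K B (c * x) ∈ factorSpan K B N
    rw [e]
    exact mulEnd_comp_mem hA hc hx.1
  have hbI : b ∈ I := by
    refine ⟨?_, hb⟩
    have e : (mulEnd K B b : N →ₗ[K] N) =
        ∑ i, LinearMap.flip (mulEnd K B) (m i) ∘ₗ (φ i).restrictScalars K := by
      ext x
      rw [LinearMap.sum_apply]
      exact hbφ x
    change mulEnd K B b ∈ factorSpan K B N
    rw [e]
    exact sum_mem fun i _ => Submodule.subset_span ⟨φ i, m i, fun x => rfl⟩
  let q' := antipodeHom hq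
  have hslice : ∀ f : C →ₗ[K] K, slice f (push q' hB.comul b) ∈ I := fun f =>
    ⟨mulEnd_slice_push_mem h hq (antipodeHom_odd hq) (mul_map_antipode_right q) hbI.1 f,
      hB.slice_push_even (antipodeHom_odd hq) hb f⟩
  -- Scalars must come from `B`, since `I` absorbs only even elements of `B`. Stability of `B` under
  -- the antipode keeps the first leg in `D`.
  let D : Submodule K C := LinearMap.range (q.toLinearMap ∘ₗ B.val.toLinearMap)
  have hD : ∃ t : D ⊗[K] B, LinearMap.rTensor B D.subtype t = push q' hB.comul b := by
    obtain ⟨s, hs⟩ := hB.comul_mem b b.2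
    let g : B →ₗ[K] D := LinearMap.codRestrict D (q'.toLinearMap ∘ₗ B.val.toLinearMap)
      fun c => ⟨⟨_, hB.antipode_mem c c.2⟩, rfl⟩
    have e1 : hB.comul b = LinearMap.rTensor B B.val.toLinearMap s := by
      apply lTensor_val_injective B
      rw [lTensor_val_comul, ← hs, ← LinearMap.comp_apply, LinearMap.lTensor_comp_rTensor]
      rfl
    refine ⟨LinearMap.rTensor B g s, ?_⟩
    rw [push, LinearMap.comp_apply, e1, ← LinearMap.comp_apply, ← LinearMap.comp_apply,
      ← LinearMap.rTensor_comp, ← LinearMap.rTensor_comp]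
    rfl
  obtain ⟨t, ht⟩ := hD
  have htI : t ∈ LinearMap.range (LinearMap.lTensor D I.subtype) := by
    refine mem_range_lTensor_of_slices I t fun f => ?_
    obtain ⟨f', hf'⟩ := f.exists_extend
    have e : slice f t = slice f' (push q' hB.comul b) := by
      rw [← ht, ← hf', slice, slice, LinearMap.comp_apply, LinearMap.comp_apply,
        LinearMap.rTensor_comp, LinearMap.comp_apply]
    rw [e]
    exact hslice f'
  -- On the pushed comultiplication of `b` this evaluates to `q(S(b₍₁₎)) q(b₍₂₎) = ε(b) = 1`, while
  -- it maps `D ⊗ I` into `q(I)`. Hence `1 = q(e)` for some `e ∈ I`.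
  let μ : C ⊗[K] B →ₗ[K] C :=
    LinearMap.mul' K C ∘ₗ LinearMap.lTensor C (q.toLinearMap ∘ₗ B.val.toLinearMap)
  have hμ1 : μ (push q' hB.comul b) = 1 := by
    have e : μ (push q' hB.comul b) = LinearMap.mul' K C (TensorProduct.map
        (q.toLinearMap ∘ₗ antipode 𝒜) q.toLinearMap (Coalgebra.comul (R := K) (b : A))) := by
      rw [← lTensor_val_comul hB, push]
      simp only [μ, ← LinearMap.comp_apply, LinearMap.comp_assoc]
      congr 2
      refine LinearMap.ext fun x => ?_
      simp only [LinearMap.comp_apply]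
      induction hB.comul x with
      | zero => simp
      | add s s' h h' => simp only [map_add, h, h']
      | tmul a c => rfl
    rw [e, mul_map_antipode_left, ← augmentation_apply (𝒜 := 𝒜), hb1, map_one]
  have hμI : ∀ s : D ⊗[K] I, ∃ e ∈ I,
      μ (LinearMap.rTensor B D.subtype (LinearMap.lTensor D I.subtype s)) = q (e : A) := by
    intro s
    induction s with
    | zero => exact ⟨0, zero_mem _, by simp⟩
    | add s s' hs hs' =>
      obtain ⟨x, hx, e⟩ := hs
      obtain ⟨x', hx', e'⟩ := hs'
      exact ⟨x + x', add_mem hx hx', by simp only [map_add, e, e', Subalgebra.coe_add]⟩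
    | tmul d x =>
      obtain ⟨_, ⟨c, rfl⟩⟩ := d
      refine ⟨hB.proj 0 c * x, hmulI (proj_mem 𝒜 0 _) x.2, ?_⟩
      rw [Subalgebra.coe_mul, map_mul, coe_proj, map_proj_zero_of_odd hq]
      rfl
  obtain ⟨s, rfl⟩ := htI
  obtain ⟨e, heI, he⟩ := hμI s
  rw [ht, hμ1] at he
  have hnil1 : IsNilpotent (1 - e) := by
    have h1 : q ((1 - e : B) : A) = 0 := by
      rw [Subalgebra.coe_sub, map_sub, ← he, Subalgebra.coe_one, map_one, sub_self]
    have h2 := hnil _ h1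
    have h3 : ((1 - e : B) : A) ∈ 𝒜 0 := (𝒜 0).sub_mem (SetLike.one_mem_graded 𝒜) heI.2
    rw [proj_of_mem 𝒜 h3] at h2
    obtain ⟨k, hk⟩ := h2
    exact ⟨k, Subtype.ext (by simpa using hk)⟩
  have h1e : ((1 - e : B) : A) ∈ 𝒜 0 := (𝒜 0).sub_mem (SetLike.one_mem_graded 𝒜) heI.2
  have h1I : (1 : B) ∈ I := by
    obtain ⟨k, hk⟩ := hnil1
    -- As `1 - e` is nilpotent, `e` has a geometric-series inverse; that inverse is even, so `1`
    -- belongs to `I`.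
    have e1 := geom_sum_mul_neg (1 - e) k
    rw [hk, sub_zero, sub_sub_cancel] at e1
    rw [← e1]
    refine hmulI ?_ heI
    rw [AddSubmonoidClass.coe_finsetSum]
    refine sum_mem fun j _ => ?_
    rw [SubmonoidClass.coe_pow]
    simpa using SetLike.pow_mem_graded j h1e
  refine projective_of_id_mem (K := K) ?_
  have : (LinearMap.id : N →ₗ[K] N) = mulEnd K B 1 := LinearMap.ext fun x => (one_smul B x).symm
  rw [this]
  exact h1I.1

end IsHopfSupersubalgebra

/-! ### Finite coideals and the Hopf submodules they generate -/

/-- A finite subset of a coalgebra lies in a finite-dimensional left coideal. -/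
theorem Coalgebra.exists_finite_coideal {K A : Type*} [Field K] [AddCommGroup A] [Module K A]
    [Coalgebra K A] (F : Set A) (hF : F.Finite) :
    ∃ V : Submodule K A, Module.Finite K V ∧ F ⊆ V ∧
      ∀ v ∈ V, comul (R := K) v ∈ LinearMap.range (LinearMap.lTensor A V.subtype) := by
  -- The right legs of the comultiplications of the elements of `F`. The slice by the counit returns
  -- `v`, and by coassociativity a slice of a slice is the slice by a convolution product of
  -- functionals.
  let V : Submodule K A :=
    Submodule.span K {w | ∃ v ∈ F, ∃ f : A →ₗ[K] K, w = TensorProduct.slice f (comul (R := K) v)}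
  refine ⟨V, ?_, fun v hv => ?_, ?_⟩
  · obtain ⟨V', hV', h⟩ := _root_.TensorProduct.exists_finite_submodule_right_of_setFinite
      ((comul (R := K) : A → A ⊗[K] A) '' F) (hF.image _)
    refine Submodule.finiteDimensional_of_le (S₂ := V') (Submodule.span_le.2 ?_)
    rintro _ ⟨v, hv, f, rfl⟩
    obtain ⟨t, ht⟩ := h ⟨v, hv, rfl⟩
    rw [← ht]
    clear ht
    induction t with
    | zero => simp
    | add s s' h h' =>
      rw [map_add, map_add]
      exact add_mem h h'
    | tmul a x =>
      rw [LinearMap.lTensor_tmul, TensorProduct.slice_tmul]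
      exact V'.smul_mem _ x.2
  · refine Submodule.subset_span ⟨v, hv, counit, ?_⟩
    rw [TensorProduct.slice, LinearMap.comp_apply, rTensor_counit_comul]
    simp
  · intro v hv
    have hle : V ≤ (LinearMap.range (LinearMap.lTensor A V.subtype)).comap (comul (R := K)) := by
      refine Submodule.span_le.2 ?_
      rintro _ ⟨v, hv, f, rfl⟩
      refine TensorProduct.mem_range_lTensor_of_slices V _ fun g => Submodule.subset_span
        ⟨v, hv, (_root_.TensorProduct.lid K K).toLinearMap ∘ₗ _root_.TensorProduct.map f g ∘ₗ comul, ?_⟩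
      have e1 : ∀ t : A ⊗[K] A, comul (R := K) (TensorProduct.slice f t) =
          TensorProduct.slice f (LinearMap.lTensor A (comul (R := K)) t) := by
        intro t
        induction t with
        | zero => simp
        | add s s' h h' => simp only [map_add, h, h']
        | tmul a x => simp [TensorProduct.slice_tmul]
      have e2 : ∀ t : A ⊗[K] A, TensorProduct.slice g (TensorProduct.slice f
          (_root_.TensorProduct.assoc K A A A (LinearMap.rTensor A comul t))) = TensorProduct.slice
          ((_root_.TensorProduct.lid K K).toLinearMap ∘ₗ _root_.TensorProduct.map f g ∘ₗ comul) t := by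
        intro t
        induction t with
        | zero => simp
        | add s s' h h' => simp only [map_add, h, h']
        | tmul a x =>
          rw [LinearMap.rTensor_tmul, TensorProduct.slice_tmul]
          simp only [LinearMap.comp_apply]
          induction comul (R := K) a with
          | zero => simp
          | add s s' h h' => simp only [map_add, TensorProduct.add_tmul, h, h', add_smul]
          | tmul y z => simp [TensorProduct.slice_tmul, mul_smul]
      rw [← e2, coassoc_apply, e1]
    exact hle hv

namespace IsHopfSupersubalgebra

open IsSupercommutative HopfSuperalgebra TensorProduct

variable {K : Type u} [Field K] {A : Type v} [Ring A] [Algebra K A] [Coalgebra K A]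
  {𝒜 : ZMod 2 → Submodule K A} [GradedAlgebra 𝒜] [HopfSuperalgebra K 𝒜] {B : Subalgebra K A}

/-- The `B`-submodule generated by a left coideal is a Hopf module. -/
theorem comul_mem_of_mem_span (hB : IsHopfSupersubalgebra 𝒜 B) {V : Submodule K A}
    (hV : ∀ v ∈ V, Coalgebra.comul (R := K) v ∈ LinearMap.range (LinearMap.lTensor A V.subtype))
    {n : A} (hn : n ∈ Submodule.span B (V : Set A)) :
    Coalgebra.comul (R := K) n ∈ LinearMap.range (LinearMap.lTensor A
      ((Submodule.span B (V : Set A)).subtype.restrictScalars K)) := by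
  induction hn using Submodule.span_induction with
  | mem v hv =>
    obtain ⟨t, ht⟩ := hV v hv
    let j : V →ₗ[K] Submodule.span B (V : Set A) :=
      { toFun := fun x => ⟨x, Submodule.subset_span x.2⟩
        map_add' := fun _ _ => rfl
        map_smul' := fun _ _ => rfl }
    refine ⟨LinearMap.lTensor A j t, ?_⟩
    rw [← ht, ← LinearMap.comp_apply, ← LinearMap.lTensor_comp]
    rfl
  | zero => simp
  | add x y _ _ hx hy =>
    rw [map_add]
    exact add_mem hx hy
  | smul b x _ hx =>
    obtain ⟨t, ht⟩ := hx
    rw [hB.isHopfModule_self.map_smul, ← ht, ← hB.lTensor_act]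
    exact ⟨_, rfl⟩

/-- Every finite subset of `A` is contained in a finitely generated projective `B`-submodule that
contains `B` as a direct summand. -/
theorem exists_projective_submodule (hB : IsHopfSupersubalgebra 𝒜 B) (hA : IsSupercommutative 𝒜)
    (hK : ringChar K ≠ 2) (F : Set A) (hF : F.Finite) :
    ∃ N : Submodule B A, F ⊆ N ∧ Module.Finite B N ∧ Module.Projective B N ∧
      ∃ h1 : (1 : A) ∈ N, ∃ r : N →ₗ[B] B, r ⟨1, h1⟩ = 1 := by
  -- Adjoining `1` makes the submodule generated by the coideal contain `B`.
  obtain ⟨V, hVf, hFV, hV⟩ := Coalgebra.exists_finite_coideal (K := K) (insert 1 F) (hF.insert 1)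
  let N := Submodule.span B (V : Set A)
  have h1 : (1 : A) ∈ N := Submodule.subset_span (hFV (Set.mem_insert _ _))
  have hfin : Module.Finite B N := by
    obtain ⟨s, hs⟩ := (Module.Finite.iff_fg.1 hVf)
    rw [Module.Finite.iff_fg]
    refine ⟨s, ?_⟩
    have := Submodule.span_span_of_tower K B (s : Set A)
    rw [hs] at this
    exact this.symm
  obtain ⟨ρ, hρ, hρN⟩ := hB.isHopfModule_self.exists_of_injective N.subtype Subtype.val_injective
    fun n => hB.comul_mem_of_mem_span hV n.2
  let ι : B →ₗ[B] N := LinearMap.toSpanSingleton B N ⟨1, h1⟩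
  have hι : ∀ b, ((ι b : N) : A) = b := fun b => mul_one (b : A)
  have hιinj : Function.Injective ι := fun b c hbc => Subtype.ext (by rw [← hι b, ← hι c, hbc])
  have hρι : ∀ b, ρ (ι b) = LinearMap.lTensor A (ι.restrictScalars K) (hB.comul b) := by
    intro b
    have i1 : Function.Injective (LinearMap.lTensor A (N.subtype.restrictScalars K)) :=
      Module.Flat.lTensor_preserves_injective_linearMap _ Subtype.val_injective
    apply i1
    rw [hρN, ← LinearMap.comp_apply (LinearMap.lTensor A _), ← LinearMap.lTensor_comp]
    have e : N.subtype.restrictScalars K ∘ₗ ι.restrictScalars K = B.val.toLinearMap :=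
      LinearMap.ext hι
    rw [e, lTensor_val_comul]
    exact congrArg _ (hι b)
  -- `N / B` is again a finitely generated Hopf module, so it is projective; a section of the
  -- quotient map gives a retraction of `N` onto `B`.
  obtain ⟨ρ', hρ'⟩ := hρ.exists_quotient (LinearMap.range ι) (by
    rintro _ ⟨b, rfl⟩
    rw [hρι, ← LinearMap.comp_apply, ← LinearMap.lTensor_comp]
    have e : (LinearMap.range ι).mkQ.restrictScalars K ∘ₗ ι.restrictScalars K = 0 :=
      LinearMap.ext fun c => (Submodule.Quotient.mk_eq_zero _).2 ⟨c, rfl⟩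
    rw [e]
    simp)
  have hproj := hρ'.projective hA hK
  obtain ⟨s, hs⟩ := Module.projective_lifting_property (LinearMap.range ι).mkQ
    (LinearMap.id : (N ⧸ LinearMap.range ι) →ₗ[B] _) (LinearMap.range ι).mkQ_surjective
  let g : N →ₗ[B] LinearMap.range ι := LinearMap.codRestrict _
    (LinearMap.id - s ∘ₗ (LinearMap.range ι).mkQ) fun n => by
      rw [← Submodule.Quotient.mk_eq_zero]
      change (LinearMap.range ι).mkQ (n - s ((LinearMap.range ι).mkQ n)) = 0
      have := LinearMap.congr_fun hs ((LinearMap.range ι).mkQ n)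
      rw [LinearMap.comp_apply, LinearMap.id_apply] at this
      rw [map_sub, this, sub_self]
  refine ⟨N, fun x hx => Submodule.subset_span (hFV (Set.mem_insert_of_mem _ hx)), hfin,
    hρ.projective hA hK, h1, (LinearEquiv.ofInjective ι hιinj).symm.toLinearMap ∘ₗ g, ?_⟩
  rw [LinearMap.comp_apply, LinearEquiv.coe_coe, LinearEquiv.symm_apply_eq]
  apply Subtype.ext
  have h0 : (LinearMap.range ι).mkQ ⟨1, h1⟩ = 0 :=
    (Submodule.Quotient.mk_eq_zero _).2 ⟨1, one_smul _ _⟩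
  change (⟨1, h1⟩ : N) - s ((LinearMap.range ι).mkQ ⟨1, h1⟩) = ι 1
  rw [h0, map_zero, sub_zero]
  exact (one_smul _ _).symm

end IsHopfSupersubalgebra

/-! ### Local projectivity -/

/-- A left module is locally projective relative to an element `e` if every finite subset has a
dual basis, and the functional `e ↦ 1` exists, where linearity is only required on the subset. -/
structure IsLocallyProjectiveLeft (R : Type*) [Ring R] {Y : Type*} [AddCommGroup Y] [Module R Y]
    (e : Y) : Prop where
  exists_dual_basis : ∀ F : Finset Y, ∃ (κ : Type) (_ : Fintype κ) (n : κ → Y) (φ : κ → Y →+ R),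
    (∀ i, ∀ y ∈ F, ∀ r : R, φ i (r • y) = r * φ i y) ∧ ∀ y ∈ F, ∑ i, φ i y • n i = y
  exists_functional : ∀ F : Finset Y, ∃ φ : Y →+ R,
    (∀ y ∈ F, ∀ r : R, φ (r • y) = r * φ y) ∧ φ e = 1

/-- The analogue of `IsLocallyProjectiveLeft` for right modules. -/
structure IsLocallyProjectiveRight (R : Type*) [Ring R] {Y : Type*} [AddCommGroup Y]
    [Module Rᵐᵒᵖ Y] (e : Y) : Prop where
  exists_dual_basis : ∀ F : Finset Y, ∃ (κ : Type) (_ : Fintype κ) (n : κ → Y) (φ : κ → Y →+ R),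
    (∀ i, ∀ y ∈ F, ∀ r : R, φ i (MulOpposite.op r • y) = φ i y * r) ∧
      ∀ y ∈ F, ∑ i, MulOpposite.op (φ i y) • n i = y
  exists_functional : ∀ F : Finset Y, ∃ φ : Y →+ R,
    (∀ y ∈ F, ∀ r : R, φ (MulOpposite.op r • y) = φ y * r) ∧ φ e = 1

namespace IsHopfSupersubalgebra

open IsSupercommutative

variable {K : Type u} [Field K] {A : Type v} [Ring A] [Algebra K A] [Coalgebra K A]
  {𝒜 : ZMod 2 → Submodule K A} [GradedAlgebra 𝒜] [HopfSuperalgebra K 𝒜] {B : Subalgebra K A}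

/-- Functionals on the submodule `N` are extended to `A` by a merely `K`-linear retraction. They
remain `B`-linear at the vectors of `N`, which is all that the definition asks. -/
theorem isLocallyProjectiveLeft (hB : IsHopfSupersubalgebra 𝒜 B) (hA : IsSupercommutative 𝒜)
    (hK : ringChar K ≠ 2) : IsLocallyProjectiveLeft B (1 : A) := by
  have retr : ∀ N : Submodule B A, ∃ p : A →ₗ[K] N, ∀ n : N, p n = n := by
    intro N
    obtain ⟨p, hp⟩ := LinearMap.exists_leftInverse_of_injective (N.subtype.restrictScalars K)
      (LinearMap.ker_eq_bot.2 Subtype.val_injective)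
    exact ⟨p, LinearMap.congr_fun hp⟩
  have lin : ∀ (N : Submodule B A) (p : A →ₗ[K] N) (_ : ∀ n : N, p n = n) (φ : N →ₗ[B] B),
      ∀ y ∈ N, ∀ r : B, φ (p (r • y)) = r * φ (p y) := by
    intro N p hp φ y hy r
    have e1 : p y = ⟨y, hy⟩ := hp ⟨y, hy⟩
    have e2 : p (r • y) = r • ⟨y, hy⟩ := hp (r • ⟨y, hy⟩)
    rw [e1, e2, map_smul, smul_eq_mul]
  constructor
  · intro F
    obtain ⟨N, hFN, hfin, hproj, -⟩ := hB.exists_projective_submodule hA hK F F.finite_toSet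
    obtain ⟨p, hp⟩ := retr N
    obtain ⟨m, f, g, -, -, hfg⟩ := Module.Finite.exists_comp_eq_id_of_projective B N
    let φ : Fin m → N →ₗ[B] B := fun i => LinearMap.proj i ∘ₗ g
    refine ⟨Fin m, inferInstance, fun i => f (Pi.single i 1),
      fun i => (φ i).toAddMonoidHom.comp p.toAddMonoidHom,
      fun i y hy => lin N p hp (φ i) y (hFN hy), fun y hy => ?_⟩
    have e1 : p y = ⟨y, hFN hy⟩ := hp ⟨y, hFN hy⟩
    have e2 := LinearMap.congr_fun hfg ⟨y, hFN hy⟩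
    rw [LinearMap.comp_apply, pi_eq_sum_univ' (g ⟨y, hFN hy⟩), map_sum] at e2
    have e3 := congrArg Subtype.val e2
    rw [AddSubmonoidClass.coe_finsetSum] at e3
    refine Eq.trans (Finset.sum_congr rfl fun i _ => ?_) e3
    change φ i (p y) • ((f (Pi.single i 1) : N) : A) = _
    rw [e1, map_smul, Submodule.coe_smul]
    rfl
  · intro F
    obtain ⟨N, hFN, -, -, h1, r, hr⟩ := hB.exists_projective_submodule hA hK F F.finite_toSet
    obtain ⟨p, hp⟩ := retr N
    refine ⟨r.toAddMonoidHom.comp p.toAddMonoidHom, fun y hy => lin N p hp r y (hFN hy), ?_⟩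
    have e1 : p 1 = ⟨1, h1⟩ := hp ⟨1, h1⟩
    change r (p 1) = 1
    rw [e1, hr]

/-- The right linear functional obtained from the component of degree `q` of a left linear
functional by introducing signs. -/
def signTwist (hB : IsHopfSupersubalgebra 𝒜 B) (q : ZMod 2) (φ : A →+ B) : A →+ B where
  toFun y := ∑ j : ZMod 2, (-1 : ℤˣ) ^ ((j + q) * q) •
    hB.proj (j + q) (φ (GradedAlgebra.proj 𝒜 j y))
  map_zero' := by simp
  map_add' x y := by simp only [map_add, smul_add, Finset.sum_add_distrib]

theorem signTwist_of_mem (hB : IsHopfSupersubalgebra 𝒜 B) (q : ZMod 2) (φ : A →+ B) {j : ZMod 2}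
    {y : A} (hy : y ∈ 𝒜 j) :
    hB.signTwist q φ y = (-1 : ℤˣ) ^ ((j + q) * q) • hB.proj (j + q) (φ y) := by
  change ∑ j : ZMod 2, (-1 : ℤˣ) ^ ((j + q) * q) •
    hB.proj (j + q) (φ (GradedAlgebra.proj 𝒜 j y)) = _
  rw [Finset.sum_eq_single j, proj_of_mem 𝒜 hy]
  · intro i _ hi
    rw [proj_of_mem_ne 𝒜 hy hi.symm, map_zero, map_zero, smul_zero]
  · simp

theorem proj_mul_of_mem (hB : IsHopfSupersubalgebra 𝒜 B) {k : ZMod 2} {b : B}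
    (hb : (b : A) ∈ 𝒜 k) (i : ZMod 2) (c : B) : hB.proj (k + i) (b * c) = b * hB.proj i c := by
  apply Subtype.ext
  rw [Subalgebra.coe_mul, coe_proj, coe_proj, Subalgebra.coe_mul, proj_mul]
  rw [Finset.sum_eq_single i, show k + i + i = k by rw [add_assoc, CharTwo.add_self_eq_zero, add_zero], proj_of_mem 𝒜 hb]
  · intro l _ hl
    rw [proj_of_mem_ne 𝒜 hb, zero_mul]
    intro h
    apply hl
    revert h
    clear hb hl
    revert k i l
    decide
  · simp

/-- For `y` of degree `j` and `b` of degree `k`, the signs `jk`, `(j+k+q)q` and `(j+q)k` add up to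
`(j+q)q` modulo 2, which is the sign built into the twist. -/
theorem signTwist_mul (hB : IsHopfSupersubalgebra 𝒜 B) (hA : IsSupercommutative 𝒜) (q : ZMod 2)
    {φ : A →+ B} {y : A}
    (hφ : ∀ (j : ZMod 2) (b : B), φ (b • GradedAlgebra.proj 𝒜 j y) =
      b * φ (GradedAlgebra.proj 𝒜 j y)) (b : B) :
    hB.signTwist q φ (y * b) = hB.signTwist q φ y * b := by
  have hom : ∀ (j k : ZMod 2) (b : B), (b : A) ∈ 𝒜 k →
      hB.signTwist q φ (GradedAlgebra.proj 𝒜 j y * b) =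
        hB.signTwist q φ (GradedAlgebra.proj 𝒜 j y) * b := by
    intro j k b hb
    have hy := proj_mem 𝒜 j y
    rw [hB.signTwist_of_mem q φ (SetLike.mul_mem_graded hy hb), hB.signTwist_of_mem q φ hy,
      hA j k _ _ hy hb]
    have e1 : ∀ s : ℤˣ, φ (s • ((b : A) * GradedAlgebra.proj 𝒜 j y)) =
        s • (b * φ (GradedAlgebra.proj 𝒜 j y)) := by
      intro s
      rw [← hφ, Units.smul_def, Units.smul_def, map_zsmul]
      rfl
    have e2 : ∀ (s : ℤˣ) (i : ZMod 2) (c : B), hB.proj i (s • c) = s • hB.proj i c := by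
      intro s i c
      rw [Units.smul_def, Units.smul_def, map_zsmul]
    have e3 : hB.proj (j + q) (φ (GradedAlgebra.proj 𝒜 j y)) * b = (-1 : ℤˣ) ^ ((j + q) * k) •
        (b * hB.proj (j + q) (φ (GradedAlgebra.proj 𝒜 j y))) := by
      apply Subtype.ext
      have := hA (j + q) k _ _
        (proj_mem 𝒜 (j + q) ((φ (GradedAlgebra.proj 𝒜 j y) : B) : A)) hb
      rw [Subalgebra.coe_mul, coe_proj, this]
      rw [Units.smul_def, Units.smul_def]
      rfl
    rw [e1, e2, show j + k + q = k + (j + q) by ring, proj_mul_of_mem hB hb, smul_mul_assoc, e3,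
      smul_smul, smul_smul, ← uzpow_add, ← uzpow_add]
    congr 2
    clear hy hb e3 e1
    revert j k q
    decide
  have e : ∀ j, hB.signTwist q φ (GradedAlgebra.proj 𝒜 j y * b) =
      hB.signTwist q φ (GradedAlgebra.proj 𝒜 j y) * b := by
    intro j
    have h0 := hom j 0 (hB.proj 0 b) (proj_mem 𝒜 0 _)
    have h1 := hom j 1 (hB.proj 1 b) (proj_mem 𝒜 1 _)
    conv_lhs => rw [← hB.proj_add_proj b]
    conv_rhs => rw [← hB.proj_add_proj b]
    rw [Subalgebra.coe_add, mul_add, map_add, h0, h1, mul_add]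
  conv_lhs => rw [← IsSupercommutative.proj_add_proj 𝒜 y]
  conv_rhs => rw [← IsSupercommutative.proj_add_proj 𝒜 y]
  rw [add_mul, map_add, map_add, e, e, add_mul]

/-- Split dual basis vectors and functionals into homogeneous components. The sign `(j+q)q` is the
cost of moving a coefficient of degree `j + q` past a basis vector of degree `q`. -/
theorem isLocallyProjectiveRight (hB : IsHopfSupersubalgebra 𝒜 B) (hA : IsSupercommutative 𝒜)
    (hK : ringChar K ≠ 2) : IsLocallyProjectiveRight B (1 : A) := by
  classical
  have hL := hB.isLocallyProjectiveLeft hA hK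
  let comps (F : Finset A) : Finset A := F.biUnion fun y =>
    Finset.univ.image fun j : ZMod 2 => GradedAlgebra.proj 𝒜 j y
  have hcomps : ∀ (F : Finset A), ∀ y ∈ F, ∀ j, GradedAlgebra.proj 𝒜 j y ∈ comps F :=
    fun F y hy j => Finset.mem_biUnion.2 ⟨y, hy, Finset.mem_image_of_mem _ (Finset.mem_univ j)⟩
  constructor
  · intro F
    obtain ⟨κ, _, n, φ, hφ, hsum⟩ := hL.exists_dual_basis (comps F)
    refine ⟨κ × ZMod 2, inferInstance, fun i => GradedAlgebra.proj 𝒜 i.2 (n i.1),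
      fun i => hB.signTwist i.2 (φ i.1), fun i y hy b => ?_, fun y hy => ?_⟩
    · exact hB.signTwist_mul hA i.2 (fun j b => hφ i.1 _ (hcomps F y hy j) b) b
    · have key : ∀ j, ∑ i : κ × ZMod 2, GradedAlgebra.proj 𝒜 i.2 (n i.1) *
          (hB.signTwist i.2 (φ i.1) (GradedAlgebra.proj 𝒜 j y) : A) =
          GradedAlgebra.proj 𝒜 j y := by
        intro j
        have e0 : GradedAlgebra.proj 𝒜 j y = GradedAlgebra.proj 𝒜 j
            (∑ i, φ i (GradedAlgebra.proj 𝒜 j y) • n i) := by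
          rw [hsum _ (hcomps F y hy j), proj_of_mem 𝒜 (proj_mem 𝒜 j y)]
        conv_rhs => rw [e0]
        rw [map_sum, Fintype.sum_prod_type]
        refine Finset.sum_congr rfl fun i _ => ?_
        rw [Subalgebra.smul_def, smul_eq_mul, proj_mul]
        refine Finset.sum_congr rfl fun q _ => ?_
        rw [hB.signTwist_of_mem q _ (proj_mem 𝒜 j y)]
        have h := hA (j + q) q _ _
          (proj_mem 𝒜 (j + q) ((φ i (GradedAlgebra.proj 𝒜 j y) : B) : A)) (proj_mem 𝒜 q (n i))
        rw [h, Units.smul_def, Units.smul_def]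
        exact mul_smul_comm _ _ _
      conv_rhs => rw [← IsSupercommutative.proj_add_proj 𝒜 y, ← key 0, ← key 1]
      rw [← Finset.sum_add_distrib]
      refine Finset.sum_congr rfl fun i _ => ?_
      rw [← mul_add, ← Subalgebra.coe_add, ← map_add, IsSupercommutative.proj_add_proj]
      rfl
  · intro F
    obtain ⟨φ, hφ, h1⟩ := hL.exists_functional (comps F)
    refine ⟨hB.signTwist 0 φ, fun y hy b => ?_, ?_⟩
    · exact hB.signTwist_mul hA 0 (fun j b => hφ _ (hcomps F y hy j) b) b
    · rw [hB.signTwist_of_mem 0 φ (SetLike.one_mem_graded 𝒜), h1]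
      have : hB.proj 0 1 = 1 := Subtype.ext (proj_of_mem 𝒜 (SetLike.one_mem_graded 𝒜))
      simp [this]

end IsHopfSupersubalgebra

/-! ### Evaluating functionals on balanced tensor products -/

namespace BalancedTensor

section

variable {R : Type*} [Ring R] {X Y : Type*} [AddCommGroup X] [Module Rᵐᵒᵖ X] [AddCommGroup Y]
  [Module R Y]

theorem smul_tmul_sub_mem (x : X) (r : R) (y : Y) :
    (MulOpposite.op r • x) ⊗ₜ[ℤ] y - x ⊗ₜ[ℤ] (r • y) ∈ relations R X Y :=
  AddSubgroup.subset_closure ⟨x, r, y, rfl⟩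

variable (X) in
/-- The map `X ⊗ Y → X`, `x ⊗ y ↦ x φ(y)`. -/
noncomputable def evalRight (φ : Y →+ R) : X ⊗[ℤ] Y →+ X :=
  TensorProduct.liftAddHom
    { toFun := fun x =>
        { toFun := fun y => MulOpposite.op (φ y) • x
          map_zero' := by simp
          map_add' := fun y y' => by simp [add_smul] }
      map_zero' := by ext; simp
      map_add' := fun x x' => by ext; simp }
    fun n x y => by
      change MulOpposite.op (φ y) • (n • x) = MulOpposite.op (φ (n • y)) • x
      rw [map_zsmul, MulOpposite.op_smul, smul_assoc, smul_comm]

omit [Module R Y] in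
theorem evalRight_tmul (φ : Y →+ R) (x : X) (y : Y) :
    evalRight X φ (x ⊗ₜ y) = MulOpposite.op (φ y) • x := rfl

variable (Y) in
/-- The map `X ⊗ Y → Y`, `x ⊗ y ↦ φ(x) y`. -/
noncomputable def evalLeft (φ : X →+ R) : X ⊗[ℤ] Y →+ Y :=
  TensorProduct.liftAddHom
    { toFun := fun x =>
        { toFun := fun y => φ x • y
          map_zero' := by simp
          map_add' := fun y y' => by simp }
      map_zero' := by ext; simp
      map_add' := fun x x' => by ext; simp [add_smul] }
    fun n x y => by
      change φ (n • x) • y = φ x • (n • y)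
      rw [map_zsmul, smul_assoc, smul_comm]

omit [Module Rᵐᵒᵖ X] in
theorem evalLeft_tmul (φ : X →+ R) (x : X) (y : Y) : evalLeft Y φ (x ⊗ₜ y) = φ x • y := rfl

/-- A given element of `relations` is a combination of finitely many generators, so linearity is
needed only at the vectors of `Y` occurring in them. -/
theorem exists_finset_evalRight_eq_zero {t : X ⊗[ℤ] Y} (ht : t ∈ relations R X Y) :
    ∃ F : Finset Y, ∀ φ : Y →+ R, (∀ y ∈ F, ∀ r : R, φ (r • y) = r * φ y) →
      evalRight X φ t = 0 := by
  classical
  induction ht using AddSubgroup.closure_induction with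
  | mem t ht =>
    obtain ⟨x, r, y, rfl⟩ := ht
    refine ⟨{y}, fun φ hφ => ?_⟩
    rw [map_sub, evalRight_tmul, evalRight_tmul, hφ y (Finset.mem_singleton_self y),
      MulOpposite.op_mul, mul_smul, sub_self]
  | zero => exact ⟨∅, fun φ _ => map_zero _⟩
  | add s t _ _ hs ht =>
    obtain ⟨F, hF⟩ := hs
    obtain ⟨G, hG⟩ := ht
    refine ⟨F ∪ G, fun φ hφ => ?_⟩
    rw [map_add, hF φ fun y hy => hφ y (Finset.mem_union_left _ hy),
      hG φ fun y hy => hφ y (Finset.mem_union_right _ hy), add_zero]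
  | neg t _ ht =>
    obtain ⟨F, hF⟩ := ht
    exact ⟨F, fun φ hφ => by rw [map_neg, hF φ hφ, neg_zero]⟩

theorem exists_finset_evalLeft_eq_zero {t : X ⊗[ℤ] Y} (ht : t ∈ relations R X Y) :
    ∃ F : Finset X, ∀ φ : X →+ R, (∀ x ∈ F, ∀ r : R, φ (MulOpposite.op r • x) = φ x * r) →
      evalLeft Y φ t = 0 := by
  classical
  induction ht using AddSubgroup.closure_induction with
  | mem t ht =>
    obtain ⟨x, r, y, rfl⟩ := ht
    refine ⟨{x}, fun φ hφ => ?_⟩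
    rw [map_sub, evalLeft_tmul, evalLeft_tmul, hφ x (Finset.mem_singleton_self x), mul_smul,
      sub_self]
  | zero => exact ⟨∅, fun φ _ => map_zero _⟩
  | add s t _ _ hs ht =>
    obtain ⟨F, hF⟩ := hs
    obtain ⟨G, hG⟩ := ht
    refine ⟨F ∪ G, fun φ hφ => ?_⟩
    rw [map_add, hF φ fun y hy => hφ y (Finset.mem_union_left _ hy),
      hG φ fun y hy => hφ y (Finset.mem_union_right _ hy), add_zero]
  | neg t _ ht =>
    obtain ⟨F, hF⟩ := ht
    exact ⟨F, fun φ hφ => by rw [map_neg, hF φ hφ, neg_zero]⟩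

/-- Expand the second factor of each pure tensor in the dual basis and move the coefficients across.
-/
theorem exists_finset_sub_sum_mem_left (t : X ⊗[ℤ] Y) :
    ∃ F : Finset Y, ∀ (κ : Type) (_ : Fintype κ) (n : κ → Y) (φ : κ → Y →+ R),
      (∀ y ∈ F, ∑ i, φ i y • n i = y) →
      t - ∑ i, evalRight X (φ i) t ⊗ₜ[ℤ] n i ∈ relations R X Y := by
  classical
  induction t with
  | zero => exact ⟨∅, fun κ _ n φ _ => by simp⟩
  | tmul x y =>
    refine ⟨{y}, fun κ _ n φ h => ?_⟩
    have hy := h y (Finset.mem_singleton_self y)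
    have e : x ⊗ₜ[ℤ] y = ∑ i, x ⊗ₜ[ℤ] (φ i y • n i) := by
      rw [← TensorProduct.tmul_sum, hy]
    rw [e, ← e, e, ← Finset.sum_sub_distrib]
    refine sum_mem fun i _ => ?_
    rw [← e, evalRight_tmul, ← neg_sub]
    exact neg_mem (smul_tmul_sub_mem x _ _)
  | add s t hs ht =>
    obtain ⟨F, hF⟩ := hs
    obtain ⟨G, hG⟩ := ht
    refine ⟨F ∪ G, fun κ _ n φ h => ?_⟩
    have h1 := hF κ _ n φ fun y hy => h y (Finset.mem_union_left _ hy)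
    have h2 := hG κ _ n φ fun y hy => h y (Finset.mem_union_right _ hy)
    have := add_mem h1 h2
    rwa [sub_add_sub_comm, ← Finset.sum_add_distrib,
      Finset.sum_congr rfl fun i _ => by rw [← TensorProduct.add_tmul, ← map_add]] at this

theorem exists_finset_sub_sum_mem_right (t : X ⊗[ℤ] Y) :
    ∃ F : Finset X, ∀ (κ : Type) (_ : Fintype κ) (n : κ → X) (φ : κ → X →+ R),
      (∀ x ∈ F, ∑ i, MulOpposite.op (φ i x) • n i = x) →
      t - ∑ i, n i ⊗ₜ[ℤ] evalLeft Y (φ i) t ∈ relations R X Y := by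
  classical
  induction t with
  | zero => exact ⟨∅, fun κ _ n φ _ => by simp⟩
  | tmul x y =>
    refine ⟨{x}, fun κ _ n φ h => ?_⟩
    have hx := h x (Finset.mem_singleton_self x)
    have e : x ⊗ₜ[ℤ] y = ∑ i, (MulOpposite.op (φ i x) • n i) ⊗ₜ[ℤ] y := by
      rw [← TensorProduct.sum_tmul, hx]
    rw [e, ← e, e, ← Finset.sum_sub_distrib]
    refine sum_mem fun i _ => ?_
    rw [← e, evalLeft_tmul]
    exact smul_tmul_sub_mem _ _ _
  | add s t hs ht =>
    obtain ⟨F, hF⟩ := hs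
    obtain ⟨G, hG⟩ := ht
    refine ⟨F ∪ G, fun κ _ n φ h => ?_⟩
    have h1 := hF κ _ n φ fun y hy => h y (Finset.mem_union_left _ hy)
    have h2 := hG κ _ n φ fun y hy => h y (Finset.mem_union_right _ hy)
    have := add_mem h1 h2
    rwa [sub_add_sub_comm, ← Finset.sum_add_distrib,
      Finset.sum_congr rfl fun i _ => by rw [← TensorProduct.tmul_add, ← map_add]] at this

end

section

variable {R : Type*} [Ring R] {X X' Y Y' : Type*} [AddCommGroup X] [Module Rᵐᵒᵖ X]
  [AddCommGroup X'] [Module Rᵐᵒᵖ X'] [AddCommGroup Y] [Module R Y] [AddCommGroup Y'] [Module R Y']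

variable (R) in
/-- The class in `X ⊗_R Y` of an element of `X ⊗_ℤ Y`. -/
def mk (t : X ⊗[ℤ] Y) : BalancedTensor R X Y := QuotientAddGroup.mk t

theorem mk_eq_zero {t : X ⊗[ℤ] Y} : mk R t = 0 ↔ t ∈ relations R X Y :=
  QuotientAddGroup.eq_zero_iff t

theorem mk_eq_mk {s t : X ⊗[ℤ] Y} : mk R s = mk R t ↔ s - t ∈ relations R X Y := by
  rw [← mk_eq_zero, ← sub_eq_zero]
  rfl

theorem mk_surjective (t : BalancedTensor R X Y) : ∃ s, mk R s = t :=
  QuotientAddGroup.mk_surjective t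

theorem map_mk (f : X →ₗ[Rᵐᵒᵖ] X') (g : Y →ₗ[R] Y') (t : X ⊗[ℤ] Y) :
    map f g (mk R t) = mk R (TensorProduct.map f.toAddMonoidHom.toIntLinearMap
      g.toAddMonoidHom.toIntLinearMap t) := rfl

theorem evalRight_map (f : X →ₗ[Rᵐᵒᵖ] X') (φ : Y →+ R) (t : X ⊗[ℤ] Y) :
    evalRight X' φ (TensorProduct.map f.toAddMonoidHom.toIntLinearMap
      (LinearMap.id : Y →ₗ[R] Y).toAddMonoidHom.toIntLinearMap t) = f (evalRight X φ t) := by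
  induction t with
  | zero => simp
  | tmul x y => exact (map_smul f (MulOpposite.op (φ y)) x).symm
  | add s t hs ht => simp only [map_add, hs, ht]

theorem evalLeft_map (f : Y →ₗ[R] Y') (φ : X →+ R) (t : X ⊗[ℤ] Y) :
    evalLeft Y' φ (TensorProduct.map (LinearMap.id : X →ₗ[Rᵐᵒᵖ] X).toAddMonoidHom.toIntLinearMap
      f.toAddMonoidHom.toIntLinearMap t) = f (evalLeft Y φ t) := by
  induction t with
  | zero => simp
  | tmul x y => exact (map_smul f (φ x) y).symm
  | add s t hs ht => simp only [map_add, hs, ht]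

end

end BalancedTensor

/-! ### From local projectivity to faithful flatness -/

open BalancedTensor

/-- If `t` dies under `g ⊗ 1`, its evaluations at a suitable dual basis lie in `ker g = im f`, and
`t` is recovered from them. Conversely, exactness at `x` is read off from `x ⊗ e` by a functional
with value one at `e`. -/
theorem isFaithfullyFlatLeft_of_isLocallyProjectiveLeft {R : Type u} [Ring R] {Y : Type v}
    [AddCommGroup Y] [Module R Y] {e : Y} (h : IsLocallyProjectiveLeft R e) :
    IsFaithfullyFlatLeft.{w} R Y := by
  classical
  intro X' X X'' _ _ _ _ _ _ f g
  constructor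
  · intro hex t
    obtain ⟨t, rfl⟩ := mk_surjective t
    constructor
    · intro ht
      rw [map_mk, mk_eq_zero] at ht
      obtain ⟨F, hF⟩ := exists_finset_evalRight_eq_zero ht
      obtain ⟨G, hG⟩ := exists_finset_sub_sum_mem_left (R := R) t
      -- `F` controls the vanishing of the evaluations and `G` the expansion of `t`; one dual basis
      -- must serve both.
      obtain ⟨κ, _, n, φ, hφ, hsum⟩ := h.exists_dual_basis (F ∪ G)
      have h1 : ∀ i, ∃ x', f x' = evalRight X (φ i) t := fun i => by
        have := hF (φ i) fun y hy => hφ i y (Finset.mem_union_left _ hy)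
        rw [evalRight_map] at this
        exact (hex _).1 this
      choose x' hx' using h1
      refine ⟨mk R (∑ i, x' i ⊗ₜ n i), ?_⟩
      have h2 := hG κ _ n φ fun y hy => hsum y (Finset.mem_union_right _ hy)
      rw [map_mk, eq_comm, mk_eq_mk, map_sum]
      simp only [← hx'] at h2
      exact h2
    · rintro ⟨s, hs⟩
      obtain ⟨s, rfl⟩ := mk_surjective s
      rw [← hs, map_mk, map_mk]
      have h0 : ∀ s : X' ⊗[ℤ] Y, TensorProduct.map g.toAddMonoidHom.toIntLinearMap
          (LinearMap.id : Y →ₗ[R] Y).toAddMonoidHom.toIntLinearMap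
          (TensorProduct.map f.toAddMonoidHom.toIntLinearMap
            (LinearMap.id : Y →ₗ[R] Y).toAddMonoidHom.toIntLinearMap s) = 0 := by
        intro s
        induction s with
        | zero => simp
        | tmul x' y =>
          change g (f x') ⊗ₜ y = 0
          rw [(hex _).2 ⟨x', rfl⟩, TensorProduct.zero_tmul]
        | add s s' hs hs' => rw [map_add, map_add, hs, hs', add_zero]
      rw [h0]
      rfl
  · intro hex x
    constructor
    · intro hx
      have h0 : map g (LinearMap.id : Y →ₗ[R] Y) (mk R (x ⊗ₜ e)) = 0 := by
        rw [map_mk]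
        change mk R (g x ⊗ₜ e) = 0
        rw [hx, TensorProduct.zero_tmul]
        rfl
      obtain ⟨s, hs⟩ := (hex _).1 h0
      obtain ⟨s, rfl⟩ := mk_surjective s
      rw [map_mk, mk_eq_mk] at hs
      obtain ⟨F, hF⟩ := exists_finset_evalRight_eq_zero hs
      obtain ⟨φ, hφ, he⟩ := h.exists_functional F
      have := hF φ hφ
      rw [map_sub, evalRight_map, evalRight_tmul, he, MulOpposite.op_one, one_smul,
        sub_eq_zero] at this
      exact ⟨_, this⟩
    · rintro ⟨x', rfl⟩
      have h0 : map g (LinearMap.id : Y →ₗ[R] Y) (mk R (f x' ⊗ₜ e)) = 0 :=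
        (hex _).2 ⟨mk R (x' ⊗ₜ e), rfl⟩
      rw [map_mk, mk_eq_zero] at h0
      obtain ⟨F, hF⟩ := exists_finset_evalRight_eq_zero h0
      obtain ⟨φ, hφ, he⟩ := h.exists_functional F
      have := hF φ hφ
      rwa [evalRight_map, evalRight_tmul, he, MulOpposite.op_one, one_smul] at this

theorem isFaithfullyFlatRight_of_isLocallyProjectiveRight {R : Type u} [Ring R] {Y : Type v}
    [AddCommGroup Y] [Module Rᵐᵒᵖ Y] {e : Y} (h : IsLocallyProjectiveRight R e) :
    IsFaithfullyFlatRight.{w} R Y := by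
  classical
  intro X' X X'' _ _ _ _ _ _ f g
  constructor
  · intro hex t
    obtain ⟨t, rfl⟩ := mk_surjective t
    constructor
    · intro ht
      rw [map_mk, mk_eq_zero] at ht
      obtain ⟨F, hF⟩ := exists_finset_evalLeft_eq_zero ht
      obtain ⟨G, hG⟩ := exists_finset_sub_sum_mem_right (R := R) t
      obtain ⟨κ, _, n, φ, hφ, hsum⟩ := h.exists_dual_basis (F ∪ G)
      have h1 : ∀ i, ∃ x', f x' = evalLeft X (φ i) t := fun i => by
        have := hF (φ i) fun y hy => hφ i y (Finset.mem_union_left _ hy)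
        rw [evalLeft_map] at this
        exact (hex _).1 this
      choose x' hx' using h1
      refine ⟨mk R (∑ i, n i ⊗ₜ x' i), ?_⟩
      have h2 := hG κ _ n φ fun y hy => hsum y (Finset.mem_union_right _ hy)
      rw [map_mk, eq_comm, mk_eq_mk, map_sum]
      simp only [← hx'] at h2
      exact h2
    · rintro ⟨s, hs⟩
      obtain ⟨s, rfl⟩ := mk_surjective s
      rw [← hs, map_mk, map_mk]
      have h0 : ∀ s : Y ⊗[ℤ] X', TensorProduct.map
          (LinearMap.id : Y →ₗ[Rᵐᵒᵖ] Y).toAddMonoidHom.toIntLinearMap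
          g.toAddMonoidHom.toIntLinearMap
          (TensorProduct.map (LinearMap.id : Y →ₗ[Rᵐᵒᵖ] Y).toAddMonoidHom.toIntLinearMap
            f.toAddMonoidHom.toIntLinearMap s) = 0 := by
        intro s
        induction s with
        | zero => simp
        | tmul y x' =>
          change y ⊗ₜ g (f x') = 0
          rw [(hex _).2 ⟨x', rfl⟩, TensorProduct.tmul_zero]
        | add s s' hs hs' => rw [map_add, map_add, hs, hs', add_zero]
      rw [h0]
      rfl
  · intro hex x
    constructor
    · intro hx
      have h0 : map (LinearMap.id : Y →ₗ[Rᵐᵒᵖ] Y) g (mk R (e ⊗ₜ x)) = 0 := by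
        rw [map_mk]
        change mk R (e ⊗ₜ g x) = 0
        rw [hx, TensorProduct.tmul_zero]
        rfl
      obtain ⟨s, hs⟩ := (hex _).1 h0
      obtain ⟨s, rfl⟩ := mk_surjective s
      rw [map_mk, mk_eq_mk] at hs
      obtain ⟨F, hF⟩ := exists_finset_evalLeft_eq_zero hs
      obtain ⟨φ, hφ, he⟩ := h.exists_functional F
      have := hF φ hφ
      rw [map_sub, evalLeft_map, evalLeft_tmul, he, one_smul,
        sub_eq_zero] at this
      exact ⟨_, this⟩
    · rintro ⟨x', rfl⟩
      have h0 : map (LinearMap.id : Y →ₗ[Rᵐᵒᵖ] Y) g (mk R (e ⊗ₜ f x')) = 0 :=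
        (hex _).2 ⟨mk R (e ⊗ₜ x'), rfl⟩
      rw [map_mk, mk_eq_zero] at h0
      obtain ⟨F, hF⟩ := exists_finset_evalLeft_eq_zero h0
      obtain ⟨φ, hφ, he⟩ := h.exists_functional F
      have := hF φ hφ
      rwa [evalLeft_map, evalLeft_tmul, he, one_smul] at this

theorem corollary5p1 {K : Type u} [Field K] (hK : ringChar K ≠ 2)
    {A : Type v} [Ring A] [Algebra K A] [Coalgebra K A]
    (𝒜 : ZMod 2 → Submodule K A) [GradedAlgebra 𝒜] [HopfSuperalgebra K 𝒜]
    (hA : IsSupercommutative 𝒜) (B : Subalgebra K A) (hB : IsHopfSupersubalgebra 𝒜 B) :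
    IsFaithfullyFlatLeft.{w} B A ∧ IsFaithfullyFlatRight.{w} B A ∧
      IsSuperFaithfullyFlatLeft.{w} (subalgebraGrading 𝒜 B) A ∧
      IsSuperFaithfullyFlatRight.{w} (subalgebraGrading 𝒜 B) A := by
  have hL : IsFaithfullyFlatLeft.{w} B A :=
    isFaithfullyFlatLeft_of_isLocallyProjectiveLeft (hB.isLocallyProjectiveLeft hA hK)
  have hR : IsFaithfullyFlatRight.{w} B A :=
    isFaithfullyFlatRight_of_isLocallyProjectiveRight (hB.isLocallyProjectiveRight hA hK)
  -- Exactness ignores the grading, so the super versions are instances of the ungraded ones.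
  exact ⟨hL, hR, fun X' X X'' _ _ _ _ _ _ _ _ _ _ _ _ f g _ _ => hL X' X X'' f g,
    fun X' X X'' _ _ _ _ _ _ _ _ _ _ _ _ f g _ _ => hR X' X X'' f g⟩
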